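/- Let $p\in\mathbb{C}$, $p\neq 0$. Let $\mathcal{B}(p)$ be the Lie conformal algebra of Block type, that is, the free $\mathbb{C}[\partial]$-module with basis $\{L_i \mid i\in\mathbb{Z}_{\ge 0}\}$ and $\lambda$-brackets $$[L_i\,{}_\lambda\, L_j]=\bigl((i+p)\partial+(i+j+2p)\lambda\bigr)L_{i+j}.$$ A conformal module over $\mathcal{B}(p)$ is a $\mathbb{C}[\partial]$-module $M$ with a $\mathbb{C}$-bilinear $\lambda$-action $\mathcal{B}(p)\times M\to\mathbb{C}[\lambda]\otimes M$, $(a,v)\mapsto a_\lambda v$, such that $(\partial a)_\lambda v=-\lambda\, a_\lambda v$, $a_\lambda(\partial v)=(\partial+\lambda)\,a_\lambda v$ and $[a_\lambda b]_{\lambda+\mu}v=a_\lambda(b_\mu v)-b_\mu(a_\lambda v)$. It is finite if it is finitely generated over $\mathbb{C}[\partial]$, nontrivial if its $\lambda$-action is not identically zero, and irreducible if it is nonzero and its only conformal submodules are $0$ and itself. **Theorem 5.1.** Let $M$ be a nontrivial finite irreducible conformal module over $\mathcal{B}(p)$. Then $M$ is free of rank one over $\mathbb{C}[\partial]$. More precisely: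 (1) If $p\neq -1$, then there are $\Delta,\alpha\in\mathbb{C}$ with $\Delta\neq 0$ such that $M\cong M_{\Delta,\alpha}=\mathbb{C}[\partial]v$, where $$L_0\,{}_\lambda\, v=p(\partial+\Delta\lambda+\alpha)v,\qquad L_i\,{}_\lambda\, v=0\quad (i\ge 1).$$ (2) If $p=-1$, then there are $\Delta,\alpha,\beta\in\mathbb{C}$ with $\Delta\neq 0$ or $\beta\neq 0$ such that $M\cong M_{\Delta,\alpha,\beta}=\mathbb{C}[\partial]v$, where $$L_0\,{}_\lambda\, v=-(\partial+\Delta\lambda+\alpha)v,\qquad L_1\,{}_\lambda\, v=\beta v,\qquad L_i\,{}_\lambda\, v=0\quad (i\ge 2).$$ -/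

import Mathlib

open Polynomial

noncomputable section

namespace Conformal

/-! Throughout, `ℂ[X]` is `ℂ[∂]`: the indeterminate `X` is the operator `∂`.  For a
`ℂ[∂]`-module `M`, the space `ℂ[λ] ⊗ M` of polynomials in `λ` with coefficients in `M` is
`PolynomialModule ℂ M`. -/

/-- The substitution `λ ↦ q(∂)` in a polynomial `∑ λᵏ mₖ ∈ ℂ[λ] ⊗ M`, the powers of `q(∂)` acting
on the coefficients: the result is `∑ q(∂)ᵏ mₖ`. -/
def lamSubst {M : Type*} [AddCommGroup M] [Module ℂ M] [Module ℂ[X] M] [IsScalarTower ℂ ℂ[X] M]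
    (q : ℂ[X]) : PolynomialModule ℂ M →ₗ[ℂ] M :=
  (Finsupp.lsum ℂ fun k : ℕ => Algebra.lsmul ℂ ℂ M (q ^ k)) ∘ₗ
    (PolynomialModule.coeffLinearEquiv ℂ ℂ).toLinearMap

/-- The value of a polynomial `∑ λᵏ mₖ ∈ ℂ[λ] ⊗ M` at a number `λ ∈ ℂ`. -/
abbrev lamEval {M : Type*} [AddCommGroup M] [Module ℂ M] [Module ℂ[X] M] [IsScalarTower ℂ ℂ[X] M]
    (l : ℂ) : PolynomialModule ℂ M →ₗ[ℂ] M :=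
  lamSubst (C l)

/-- A Lie conformal algebra structure on the `ℂ[∂]`-module `R`.  The axioms are identities between
polynomials in `λ` and `μ` with coefficients in `R`; as `ℂ` is infinite, such an identity
holds if and only if it holds for all complex values of `λ` and `μ`, and so it is written here. -/
structure LieConformalAlgebra (R : Type*) [AddCommGroup R] [Module ℂ R] [Module ℂ[X] R]
    [IsScalarTower ℂ ℂ[X] R] where
  /-- the `λ`-bracket `[a _λ b] ∈ ℂ[λ] ⊗ R` -/
  bracket : R →ₗ[ℂ] R →ₗ[ℂ] PolynomialModule ℂ R
  /-- `[∂a _λ b] = -λ [a _λ b]` -/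
  del_bracket (a b : R) (l : ℂ) :
    lamEval l (bracket ((X : ℂ[X]) • a) b) = -(l • lamEval l (bracket a b))
  /-- `[a _λ ∂b] = (∂ + λ) [a _λ b]` -/
  bracket_del (a b : R) (l : ℂ) :
    lamEval l (bracket a ((X : ℂ[X]) • b)) = (X + C l : ℂ[X]) • lamEval l (bracket a b)
  /-- `[a _λ b] = -[b _{-λ-∂} a]` -/
  skew (a b : R) (l : ℂ) :
    lamEval l (bracket a b) = -lamSubst (-C l - X) (bracket b a)
  /-- `[a _λ [b _μ c]] = [[a _λ b] _{λ+μ} c] + [b _μ [a _λ c]]` -/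
  jacobi (a b c : R) (l m : ℂ) :
    lamEval l (bracket a (lamEval m (bracket b c))) =
      lamEval (l + m) (bracket (lamEval l (bracket a b)) c) +
        lamEval m (bracket b (lamEval l (bracket a c)))

/-- A conformal module structure on the `ℂ[∂]`-module `M` over the Lie conformal algebra `A`. -/
structure ConformalModule {R : Type*} [AddCommGroup R] [Module ℂ R] [Module ℂ[X] R]
    [IsScalarTower ℂ ℂ[X] R] (A : LieConformalAlgebra R)
    (M : Type*) [AddCommGroup M] [Module ℂ M] [Module ℂ[X] M] [IsScalarTower ℂ ℂ[X] M] where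
  /-- the `λ`-action `a _λ v ∈ ℂ[λ] ⊗ M` -/
  act : R →ₗ[ℂ] M →ₗ[ℂ] PolynomialModule ℂ M
  /-- `(∂a) _λ v = -λ (a _λ v)` -/
  del_act (a : R) (v : M) (l : ℂ) :
    lamEval l (act ((X : ℂ[X]) • a) v) = -(l • lamEval l (act a v))
  /-- `a _λ (∂v) = (∂ + λ) (a _λ v)` -/
  act_del (a : R) (v : M) (l : ℂ) :
    lamEval l (act a ((X : ℂ[X]) • v)) = (X + C l : ℂ[X]) • lamEval l (act a v)
  /-- `[a _λ b] _{λ+μ} v = a _λ (b _μ v) - b _μ (a _λ v)` -/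
  bracket_act (a b : R) (v : M) (l m : ℂ) :
    lamEval (l + m) (act (lamEval l (A.bracket a b)) v) =
      lamEval l (act a (lamEval m (act b v))) - lamEval m (act b (lamEval l (act a v)))

namespace ConformalModule

variable {R : Type*} [AddCommGroup R] [Module ℂ R] [Module ℂ[X] R] [IsScalarTower ℂ ℂ[X] R]
  {A : LieConformalAlgebra R}
  {M : Type*} [AddCommGroup M] [Module ℂ M] [Module ℂ[X] M] [IsScalarTower ℂ ℂ[X] M]
  {M' : Type*} [AddCommGroup M'] [Module ℂ M'] [Module ℂ[X] M'] [IsScalarTower ℂ ℂ[X] M']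

/-- The `λ`-action is not identically zero. -/
def IsNontrivial (ρ : ConformalModule A M) : Prop :=
  ∃ (a : R) (v : M), ρ.act a v ≠ 0

/-- The conformal module is finite: it is finitely generated over `ℂ[∂]`. -/
def IsFinite (_ρ : ConformalModule A M) : Prop :=
  Module.Finite ℂ[X] M

/-- A `ℂ[∂]`-submodule `N` is a conformal submodule if `a _λ v ∈ ℂ[λ] ⊗ N` for `v ∈ N`. -/
def IsSubmodule (ρ : ConformalModule A M) (N : Submodule ℂ[X] M) : Prop :=
  ∀ (a : R), ∀ v ∈ N, ∀ k : ℕ, (ρ.act a v).coeff k ∈ N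

/-- The module is nonzero, and `0` and the whole module are its only conformal submodules. -/
def IsIrreducible (ρ : ConformalModule A M) : Prop :=
  Nontrivial M ∧ ∀ N : Submodule ℂ[X] M, ρ.IsSubmodule N → N = ⊥ ∨ N = ⊤

/-- The underlying `ℂ[∂]`-module is free of rank one. -/
def IsFreeOfRankOne (_ρ : ConformalModule A M) : Prop :=
  Module.Free ℂ[X] M ∧ Module.rank ℂ[X] M = 1

/-- Isomorphism of conformal modules: a `ℂ[∂]`-linear bijection `φ` with
`a _λ φ(v) = φ(a _λ v)`, where `φ` is applied to the coefficients on the right. -/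
def Isomorphic (ρ : ConformalModule A M) (ρ' : ConformalModule A M') : Prop :=
  ∃ φ : M ≃ₗ[ℂ[X]] M', ∀ (a : R) (v : M) (k : ℕ),
    (ρ'.act a (φ v)).coeff k = φ ((ρ.act a v).coeff k)

end ConformalModule

/-! ### Sesquilinear extension

In `ℂ[X][X]` the outer indeterminate is `λ` and the inner one is `∂`. -/

/-- `(f, g) ↦ f(-λ) g(∂ + λ) P(∂, λ)`, the coefficient of `(f(∂) a) _λ (g(∂) b)` when
`a _λ b` has the coefficient `P(∂, λ)`. -/
def sesq (P : ℂ[X][X]) : ℂ[X] →ₗ[ℂ] ℂ[X] →ₗ[ℂ] ℂ[X][X] :=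
  ((LinearMap.mul ℂ ℂ[X][X]).compl₁₂ (aeval (-X : ℂ[X][X])).toLinearMap
    (aeval (C X + X : ℂ[X][X])).toLinearMap).compr₂ (LinearMap.mulLeft ℂ P)

/-- A polynomial in `∂` and `λ`, regarded as an element of `ℂ[λ] ⊗ ℂ[∂]`. -/
def toPolyMod : ℂ[X][X] →ₗ[ℂ] PolynomialModule ℂ ℂ[X] :=
  (PolynomialModule.equivPolynomial (R := ℂ) (S := ℂ[X])).symm.toLinearMap

/-- The `λ`-bracket of the free `ℂ[∂]`-module with basis `Lᵢ`, `i ∈ ℕ`, that is given on this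
basis by `[Lᵢ _λ Lⱼ] = P i j (∂, λ) Lᵢ₊ⱼ`. -/
def gradedBracket (P : ℕ → ℕ → ℂ[X][X]) :
    (ℕ →₀ ℂ[X]) →ₗ[ℂ] (ℕ →₀ ℂ[X]) →ₗ[ℂ] PolynomialModule ℂ (ℕ →₀ ℂ[X]) :=
  Finsupp.lsum ℂ fun i => LinearMap.flip <| Finsupp.lsum ℂ fun j => LinearMap.flip <|
    (sesq (P i j)).compr₂
      (PolynomialModule.map ℂ (Finsupp.lsingle (i + j)) ∘ₗ toPolyMod)

/-- The `λ`-action of the free `ℂ[∂]`-module with basis `Lᵢ`, `i ∈ ℕ`, on `ℂ[∂] v` that is given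
by `Lᵢ _λ v = P i (∂, λ) v`. -/
def rankOneAct (P : ℕ → ℂ[X][X]) :
    (ℕ →₀ ℂ[X]) →ₗ[ℂ] ℂ[X] →ₗ[ℂ] PolynomialModule ℂ ℂ[X] :=
  Finsupp.lsum ℂ fun i => (sesq (P i)).compr₂ toPolyMod

lemma lamSubst_single {M : Type*} [AddCommGroup M] [Module ℂ M] [Module ℂ[X] M]
    [IsScalarTower ℂ ℂ[X] M] (q : ℂ[X]) (k : ℕ) (m : M) :
    lamSubst q (PolynomialModule.single ℂ k m) = q ^ k • m := by
  simp only [lamSubst, LinearMap.comp_apply, LinearEquiv.coe_coe,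
    PolynomialModule.coeffLinearEquiv_apply, PolynomialModule.coeff_single,
    Finsupp.lsum_single, Algebra.lsmul_coe]

lemma sesq_eval (P : ℂ[X][X]) (f g q : ℂ[X]) :
    (sesq P f g).eval q = P.eval q * (f.comp (-q) * g.comp (X + q)) := by
  have h (s : ℂ[X][X]) (f : ℂ[X]) : (aeval s f).eval q = f.comp (s.eval q) := by
    induction f using Polynomial.induction_on' with
    | add f g hf hg => simp [hf, hg]
    | monomial n a => simp [aeval_monomial, IsScalarTower.algebraMap_apply ℂ ℂ[X] ℂ[X][X]]
  simp [sesq, h]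

lemma lamSubst_toPolyMod (F : ℂ[X][X]) (q : ℂ[X]) : lamSubst q (toPolyMod F) = F.eval q := by
  induction F using Polynomial.induction_on' with
  | add f g hf hg => simp [hf, hg]
  | monomial n a => simp [toPolyMod, lamSubst_single, mul_comm]

lemma lamSubst_map_toPolyMod (F : ℂ[X][X]) (q : ℂ[X]) (n : ℕ) :
    lamSubst q (PolynomialModule.map ℂ (Finsupp.lsingle (R := ℂ) n) (toPolyMod F)) =
      Finsupp.single n (F.eval q) := by
  induction F using Polynomial.induction_on' with
  | add f g hf hg => simp [hf, hg]
  | monomial k a => simp [toPolyMod, lamSubst_single, mul_comm]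

lemma lamSubst_gradedBracket (P : ℕ → ℕ → ℂ[X][X]) (i j : ℕ) (f g q : ℂ[X]) :
    lamSubst q (gradedBracket P (Finsupp.single i f) (Finsupp.single j g)) =
      Finsupp.single (i + j) ((P i j).eval q * (f.comp (-q) * g.comp (X + q))) := by
  simp [gradedBracket, lamSubst_map_toPolyMod, sesq_eval]

lemma lamSubst_rankOneAct (P : ℕ → ℂ[X][X]) (i : ℕ) (f g q : ℂ[X]) :
    lamSubst q (rankOneAct P (Finsupp.single i f) g) =
      (P i).eval q * (f.comp (-q) * g.comp (X + q)) := by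
  simp [rankOneAct, lamSubst_toPolyMod, sesq_eval]

/-! ### The Lie conformal algebra of Block type -/

/-- `(i + p) ∂ + (i + j + 2p) λ` -/
def blockCoeff (p : ℂ) (i j : ℕ) : ℂ[X][X] :=
  C (C ((i : ℂ) + p) * X) + C (C ((i : ℂ) + j + 2 * p)) * X

lemma blockCoeff_eval (p : ℂ) (i j : ℕ) (q : ℂ[X]) :
    (blockCoeff p i j).eval q = C ((i : ℂ) + p) * X + C ((i : ℂ) + j + 2 * p) * q := by
  simp only [blockCoeff, eval_add, eval_mul, eval_C, eval_X]

/-- The Lie conformal algebra `B(p)`: the free `ℂ[∂]`-module with basis `Lᵢ = Finsupp.single i 1`,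
`i ∈ ℕ`, and `[Lᵢ _λ Lⱼ] = ((i + p) ∂ + (i + j + 2p) λ) Lᵢ₊ⱼ`. -/
def block (p : ℂ) : LieConformalAlgebra (ℕ →₀ ℂ[X]) where
  bracket := gradedBracket (blockCoeff p)
  del_bracket a b l := by
    induction a using Finsupp.induction_linear with
    | zero => simp
    | add a a' h h' => simp only [smul_add, map_add, LinearMap.add_apply, h, h']; abel
    | single i f =>
      induction b using Finsupp.induction_linear with
      | zero => simp
      | add b b' h h' => simp only [smul_add, map_add, h, h']; abel
      | single j g =>
        simp only [lamEval, Finsupp.smul_single, lamSubst_gradedBracket, ← Finsupp.single_neg,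
          smul_eq_mul, smul_eq_C_mul, mul_comp, X_comp]
        congr 1; ring
  bracket_del a b l := by
    induction a using Finsupp.induction_linear with
    | zero => simp
    | add a a' h h' => simp only [smul_add, map_add, LinearMap.add_apply, h, h']
    | single i f =>
      induction b using Finsupp.induction_linear with
      | zero => simp
      | add b b' h h' => simp only [smul_add, map_add, h, h']
      | single j g =>
        simp only [lamEval, Finsupp.smul_single, lamSubst_gradedBracket,
          smul_eq_mul, mul_comp, X_comp]
        congr 1; ring
  skew a b l := by
    induction a using Finsupp.induction_linear with
    | zero => simp
    | add a a' h h' => simp only [map_add, LinearMap.add_apply, h, h']; abel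
    | single i f =>
      induction b using Finsupp.induction_linear with
      | zero => simp
      | add b b' h h' => simp only [map_add, LinearMap.add_apply, h, h']; abel
      | single j g =>
        simp only [lamEval, lamSubst_gradedBracket, ← Finsupp.single_neg, add_comm j i]
        congr 1
        have h1 : (X + (-C l - X) : ℂ[X]) = -C l := by ring
        have h2 : (-(-C l - X) : ℂ[X]) = X + C l := by ring
        rw [h1, h2]
        simp only [blockCoeff_eval, map_add, map_mul, map_ofNat]
        ring
  jacobi a b c l m := by
    induction a using Finsupp.induction_linear with
    | zero => simp
    | add a a' h h' => simp only [map_add, LinearMap.add_apply, h, h']; abel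
    | single i f =>
      induction b using Finsupp.induction_linear with
      | zero => simp
      | add b b' h h' => simp only [map_add, LinearMap.add_apply, h, h']; abel
      | single j g =>
        induction c using Finsupp.induction_linear with
        | zero => simp
        | add c c' h h' => simp only [map_add, h, h']; abel
        | single k h =>
          simp only [lamEval, lamSubst_gradedBracket, ← add_assoc, add_comm j i, ← Finsupp.single_add]
          congr 1
          simp only [blockCoeff_eval, mul_comp, add_comp, C_comp, X_comp, comp_assoc, neg_comp,
            Nat.cast_add, map_add, neg_add_rev]
          simp only [map_mul, map_ofNat]
          ring_nf

lemma lamEval_block (p : ℂ) (i j : ℕ) (f g : ℂ[X]) (l : ℂ) :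
    lamEval l ((block p).bracket (Finsupp.single i f) (Finsupp.single j g)) =
      Finsupp.single (i + j) ((C ((i : ℂ) + p) * X + C ((i : ℂ) + j + 2 * p) * C l) *
        (f.comp (-C l) * g.comp (X + C l))) := by
  simp [block, lamSubst_gradedBracket, blockCoeff]

/-- The conformal `B(p)`-module `ℂ[∂] v`, `v = 1`, with `Lᵢ _λ v = P i (∂, λ) v`; the hypothesis
says that `[Lᵢ _λ Lⱼ] _{λ+μ} v = Lᵢ _λ (Lⱼ _μ v) - Lⱼ _μ (Lᵢ _λ v)`. -/
def rankOneModule (p : ℂ) (P : ℕ → ℂ[X][X])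
    (hP : ∀ (i j : ℕ) (l m : ℂ),
      C (-(i + p) * (l + m) + (i + j + 2 * p) * l) * (P (i + j)).eval (C (l + m)) =
        ((P j).eval (C m)).comp (X + C l) * (P i).eval (C l) -
          ((P i).eval (C l)).comp (X + C m) * (P j).eval (C m)) :
    ConformalModule (block p) ℂ[X] where
  act := rankOneAct P
  del_act a v l := by
    induction a using Finsupp.induction_linear with
    | zero => simp
    | add a a' h h' => simp only [smul_add, map_add, LinearMap.add_apply, h, h']; abel
    | single i f =>
      simp only [lamEval, Finsupp.smul_single, lamSubst_rankOneAct, smul_eq_mul, smul_eq_C_mul,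
        mul_comp, X_comp]
      ring
  act_del a v l := by
    induction a using Finsupp.induction_linear with
    | zero => simp
    | add a a' h h' => simp only [smul_add, map_add, LinearMap.add_apply, h, h']
    | single i f =>
      simp only [lamEval, lamSubst_rankOneAct, smul_eq_mul, mul_comp, X_comp]
      ring
  bracket_act a b v l m := by
    induction a using Finsupp.induction_linear with
    | zero => simp
    | add a a' h h' => simp only [map_add, LinearMap.add_apply, h, h']; abel
    | single i f =>
      induction b using Finsupp.induction_linear with
      | zero => simp
      | add b b' h h' => simp only [map_add, LinearMap.add_apply, h, h']; abel
      | single j g =>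
        rw [lamEval_block]
        simp only [lamEval, lamSubst_rankOneAct]
        have key := hP i j l m
        have h1 : (-C (l + m) + C l : ℂ[X]) = -C m := by simp only [map_add]; ring
        have h2 : (X + C m + C l : ℂ[X]) = X + C l + C m := by ring
        have h3 : (X + C (l + m) : ℂ[X]) = X + C l + C m := by simp only [map_add]; ring
        simp only [mul_comp, add_comp, C_comp, X_comp, comp_assoc, neg_comp, h1, h2, h3]
        simp only [map_add, map_mul, map_neg] at key ⊢
        linear_combination (f.comp (-C l) * g.comp (-C m) * v.comp (X + C l + C m)) * key

/-- The conformal `B(p)`-module `M_{Δ,α} = ℂ[∂] v`, where `v = 1`: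
`L₀ _λ v = p (∂ + Δ λ + α) v`, and `Lᵢ _λ v = 0` for `i ≥ 1`. -/
def modM (p Δ α : ℂ) : ConformalModule (block p) ℂ[X] :=
  rankOneModule p
    (fun i => if i = 0 then C (C p) * (C X + C (C Δ) * X + C (C α)) else 0) <| by
    intro i j l m
    rcases i with _ | i <;> rcases j with _ | j <;> simp
    simp only [map_ofNat]
    ring

/-- The conformal `B(-1)`-module `M_{Δ,α,β} = ℂ[∂] v`, where `v = 1`:
`L₀ _λ v = -(∂ + Δ λ + α) v`, `L₁ _λ v = β v`, and `Lᵢ _λ v = 0` for `i ≥ 2`. -/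
def modN (Δ α β : ℂ) : ConformalModule (block (-1)) ℂ[X] :=
  rankOneModule (-1)
    (fun i => if i = 0 then -(C X + C (C Δ) * X + C (C α)) else if i = 1 then C (C β) else 0) <| by
    intro i j l m
    rcases i with _ | _ | i <;> rcases j with _ | _ | j <;> simp
    case succ.succ.succ.succ =>
      exact Or.inr (by rw [if_neg (by omega), eval_zero])
    all_goals
      simp only [map_ofNat]
      ring

end Conformal

end

noncomputable section

namespace Conformal

/-! ### Polynomials in `λ` with coefficients in `M`, determined by their values -/

section PolynomialValued

variable {M : Type*} [AddCommGroup M] [Module ℂ M]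

/-! Write `Lᵢ(n)` for the coefficient of `λⁿ` in `Lᵢ _λ`. The zero modes `Lⱼ(0)` are `ℂ[∂]`-linear
and satisfy `[Lᵢ _λ, Lⱼ(0)] = (j + p) λ Lᵢ₊ⱼ _λ`. Nontriviality and irreducibility make `M`
torsion-free. Since `L₀(0) - p∂` commutes with all fields, a Schur lemma gives `L₀(0) = pδ` with `δ
= ∂ + α`.

The operator `D = p⁻¹ L₀(1)` grades `M`: `Lⱼ(n)` shifts weights by `j/p + 1 - n`, and `δ` shifts
them by 1. `D` is locally finite, so finitely many generalised weight spaces generate `M`. Hence all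
weights lie in a finite set plus `ℕ`, and there is a lowest weight.

The main point is that the higher fields vanish. A non-nilpotent `Lⱼ(0)` of nonzero weight has
rational positive weight, and a power of integral weight `e` has an eigenvector with eigenvalue
`κδᵉ`, `κ ≠ 0` (a homogeneous Cayley–Hamilton argument). Comparing weights and degrees in `λ` shows
that some `Lⱼ(0)` with `j + p ≠ 0` is nilpotent (`exists_isNilpotent_zeroMode`), and commutators
with it kill all `Lₖ` with `k` large (`field_eventually_zero`). The last nonzero field commutes with
the zero modes of positive index, which gives a contradiction as long as some admissible index is
available (`field_eq_zero_of_top`); descending leaves only `L₀`, and also `L₁` if `p = -1`.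

A lowest weight eigenvector `u` is killed by the modes of negative integral weight, so `L₀ _λ u =
p(δ + Δλ)u` and, if `p = -1`, `L₁ _λ u = βu`. Thus `ℂ[∂]u` is a submodule and equals `M`. If all
parameters that must not vanish together did vanish, `δu` would span a proper nonzero submodule. -/

lemma eq_zero_of_forall_sum_pow_smul {s : Finset ℕ} {f : ℕ → M}
    (h : ∀ l : ℂ, ∑ n ∈ s, l ^ n • f n = 0) {n : ℕ} (hn : n ∈ s) : f n = 0 := by
  rw [← Module.forall_dual_apply_eq_zero_iff ℂ]
  intro φ
  have key : (∑ k ∈ s, monomial k (φ (f k)) : ℂ[X]) = 0 := by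
    refine Polynomial.funext fun l => ?_
    have := congrArg φ (h l)
    simp only [map_sum, map_smul, smul_eq_mul, map_zero] at this
    simp only [eval_finsetSum, eval_monomial, eval_zero]
    rw [← this]
    exact Finset.sum_congr rfl fun _ _ => mul_comm _ _
  have := congrArg (fun q => q.coeff n) key
  simpa only [finsetSum_coeff, coeff_monomial, coeff_zero, Finset.sum_ite_eq', if_pos hn] using this

lemma finsupp_eq_zero_of_forall_sum_pow_smul (x : ℕ →₀ M)
    (h : ∀ l : ℂ, (x.sum fun n m => l ^ n • m) = 0) : x = 0 := by
  ext n
  by_cases hn : n ∈ x.support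
  · exact eq_zero_of_forall_sum_pow_smul h hn
  · simpa using hn

variable [Module ℂ[X] M] [IsScalarTower ℂ ℂ[X] M]

lemma C_smul (c : ℂ) (v : M) : (C c : ℂ[X]) • v = c • v := algebraMap_smul ℂ[X] c v

lemma eval_C_apply (l : ℂ) (x : PolynomialModule ℂ[X] M) :
    PolynomialModule.eval (C l) x = x.coeff.sum fun n m => l ^ n • m := by
  rw [PolynomialModule.eval_apply]
  refine Finsupp.sum_congr fun n _ => ?_
  rw [← C_pow, C_smul]

lemma lamEval_apply (l : ℂ) (x : PolynomialModule ℂ M) :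
    lamEval l x = x.coeff.sum fun n m => l ^ n • m := by
  simp only [lamEval, lamSubst, LinearMap.comp_apply, LinearEquiv.coe_coe,
    PolynomialModule.coeffLinearEquiv_apply, Finsupp.lsum_apply, Algebra.lsmul_coe]
  refine Finsupp.sum_congr fun n _ => ?_
  rw [← C_pow, C_smul]

lemma polynomialModule_ext_eval {x y : PolynomialModule ℂ[X] M}
    (h : ∀ l : ℂ, PolynomialModule.eval (C l : ℂ[X]) x = PolynomialModule.eval (C l : ℂ[X]) y) :
    x = y := by
  rw [← sub_eq_zero, ← PolynomialModule.coeff_eq_zero]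
  refine finsupp_eq_zero_of_forall_sum_pow_smul _ fun l => ?_
  rw [← eval_C_apply, map_sub, h l, sub_self]

lemma coeff_eq_zero_of_lamEval {x : PolynomialModule ℂ M} (h : ∀ l : ℂ, lamEval l x = 0) (n : ℕ) :
    x.coeff n = 0 := by
  rw [finsupp_eq_zero_of_forall_sum_pow_smul x.coeff fun l => by rw [← lamEval_apply, h l]]
  rfl

/-- `f(∂) ↦ f(∂ + λ)`. -/
def shift : ℂ[X] →ₐ[ℂ] ℂ[X][X] := aeval (C X + X : ℂ[X][X])

lemma shift_eval (f q : ℂ[X]) : (shift f).eval q = f.comp (X + q) := by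
  induction f using Polynomial.induction_on' with
  | add f g hf hg => simp [hf, hg]
  | monomial n a =>
    simp [shift, aeval_monomial, IsScalarTower.algebraMap_apply ℂ ℂ[X] ℂ[X][X]]

end PolynomialValued

/-! ### Coefficients and degrees in `λ` -/

section Coefficients

variable {M : Type*} [AddCommGroup M]

lemma coeff_map_polynomialModule {M' : Type*} [AddCommGroup M'] {R : Type*} [CommRing R]
    [Module R M] [Module R M']
    (f : M →ₗ[R] M') (x : PolynomialModule R M) (n : ℕ) :
    (PolynomialModule.map R f x).coeff n = f (x.coeff n) := by
  simp [PolynomialModule.map]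

variable [Module ℂ[X] M]

lemma coeff_smul_of_degree_le {q : ℂ[X][X]} {e d : ℕ} (hq : q.natDegree ≤ e)
    {x : PolynomialModule ℂ[X] M} (hx : ∀ n, d < n → x.coeff n = 0) :
    (∀ n, e + d < n → (q • x).coeff n = 0) ∧
      (q • x).coeff (e + d) = q.coeff e • x.coeff d := by
  constructor
  · intro n hn
    rw [PolynomialModule.smul_apply]
    refine Finset.sum_eq_zero fun y hy => ?_
    replace hy := Finset.HasAntidiagonal.mem_antidiagonal.1 hy
    by_cases h : e < y.1
    · rw [coeff_eq_zero_of_natDegree_lt (by omega), zero_smul]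
    · rw [hx _ (by omega), smul_zero]
  · rw [PolynomialModule.smul_apply, Finset.sum_eq_single (e, d)]
    · intro y hy hne
      replace hy := Finset.HasAntidiagonal.mem_antidiagonal.1 hy
      by_cases h : e < y.1
      · rw [coeff_eq_zero_of_natDegree_lt (by omega), zero_smul]
      · rw [hx _ (by
          have : ¬ (y.1 = e ∧ y.2 = d) := fun h => hne (Prod.ext h.1 h.2)
          omega), smul_zero]
    · intro h; simp at h

lemma exists_top_coeff {x : PolynomialModule ℂ[X] M} (hx : x ≠ 0) :
    ∃ d, x.coeff d ≠ 0 ∧ ∀ n, d < n → x.coeff n = 0 := by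
  have hne : x.coeff.support.Nonempty := by
    rw [Finsupp.support_nonempty_iff]; simpa using hx
  refine ⟨x.coeff.support.max' hne, ?_, fun n hn => ?_⟩
  · exact Finsupp.mem_support_iff.1 (Finset.max'_mem _ hne)
  · by_contra h
    exact absurd (Finset.le_max' _ n (Finsupp.mem_support_iff.2 h)) (by omega)

lemma coeff_X_smul_succ (x : PolynomialModule ℂ[X] M) (n : ℕ) :
    ((X : ℂ[X][X]) • x).coeff (n + 1) = x.coeff n := by
  rw [← monomial_one_one_eq_X, PolynomialModule.monomial_smul_apply]; simp

lemma coeff_X_smul_zero (x : PolynomialModule ℂ[X] M) :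
    ((X : ℂ[X][X]) • x).coeff 0 = 0 := by
  rw [← monomial_one_one_eq_X, PolynomialModule.monomial_smul_apply]; simp

lemma X_smul_eq_zero {x : PolynomialModule ℂ[X] M} (h : (X : ℂ[X][X]) • x = 0) : x = 0 := by
  rw [← PolynomialModule.coeff_eq_zero]
  ext n
  rw [← coeff_X_smul_succ, h]; rfl

lemma coeff_C_smul (f : ℂ[X]) (x : PolynomialModule ℂ[X] M) (n : ℕ) :
    ((C f : ℂ[X][X]) • x).coeff n = f • x.coeff n := by
  rw [← monomial_zero_left, PolynomialModule.monomial_smul_apply]; simp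

/-- First-order Taylor expansion: `x(λ + c) = x(c) + λ x'(c) + ⋯`. The factor `c` in the second part
turns `n cⁿ⁻¹` into `n cⁿ` and so avoids the exponent `n - 1`. -/
lemma coeff_comp_zero_one (c : ℂ[X]) (x : PolynomialModule ℂ[X] M) :
    (PolynomialModule.comp (X + C c) x).coeff 0 = (x.coeff.sum fun n m => c ^ n • m) ∧
    c • (PolynomialModule.comp (X + C c) x).coeff 1 =
      (x.coeff.sum fun n m => c ^ n • (n • m)) := by
  induction x using PolynomialModule.induction_linear with
  | zero => simp
  | add x y hx hy =>
    constructor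
    · rw [map_add, PolynomialModule.coeff_add, Finsupp.add_apply, hx.1, hy.1,
        PolynomialModule.coeff_add, Finsupp.sum_add_index'] <;> simp
    · rw [map_add, PolynomialModule.coeff_add, Finsupp.add_apply, smul_add, hx.2, hy.2,
        PolynomialModule.coeff_add, Finsupp.sum_add_index'] <;> simp
  | single n m =>
    rw [PolynomialModule.comp_single, PolynomialModule.coeff_single,
      Finsupp.sum_single_index (by simp), Finsupp.sum_single_index (by simp)]
    constructor
    · simp [coeff_X_add_C_pow]
    · rw [PolynomialModule.smul_single_apply, if_pos (by omega), coeff_X_add_C_pow]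
      rcases n with _ | n
      · simp
      · rw [← Nat.cast_smul_eq_nsmul ℂ[X], smul_smul, smul_smul]
        congr 1
        simp; ring

end Coefficients

/-! ### The fields `Lᵢ _λ`, their modes and commutators -/

section BlockModule

variable {p : ℂ} {M : Type*} [AddCommGroup M] [Module ℂ M] [Module ℂ[X] M] [IsScalarTower ℂ ℂ[X] M]
  (ρ : ConformalModule (block p) M)

lemma lamEval_act_single (i : ℕ) (f g : ℂ[X]) (v : M) (l : ℂ) :
    lamEval l (ρ.act (Finsupp.single i f) (g • v)) =
      (f.comp (-C l) * g.comp (X + C l)) • lamEval l (ρ.act (Finsupp.single i 1) v) := by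
  have hf : ∀ (f : ℂ[X]) (w : M), lamEval l (ρ.act (Finsupp.single i f) w) =
      f.comp (-C l) • lamEval l (ρ.act (Finsupp.single i 1) w) := by
    intro f w
    induction f using Polynomial.induction_on with
    | C a =>
      rw [C_comp, C_smul, ← map_smul, ← LinearMap.smul_apply, ← map_smul, Finsupp.smul_single,
        smul_eq_C_mul, mul_one]
    | add f g hf hg =>
      rw [Finsupp.single_add, map_add, LinearMap.add_apply, map_add, hf, hg, add_comp, add_smul]
    | monomial n a ih =>
      have : Finsupp.single i (C a * X ^ (n + 1)) =
          (X : ℂ[X]) • Finsupp.single i (C a * X ^ n : ℂ[X]) := by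
        rw [Finsupp.smul_single, smul_eq_mul]; congr 1; ring
      rw [this, ρ.del_act, ih, ← C_smul, ← neg_smul, smul_smul]
      congr 1
      simp; ring
  have hg : ∀ w : M, lamEval l (ρ.act (Finsupp.single i 1) (g • w)) =
      g.comp (X + C l) • lamEval l (ρ.act (Finsupp.single i 1) w) := by
    intro w
    induction g using Polynomial.induction_on with
    | C a => rw [C_comp, C_smul, C_smul, map_smul, map_smul]
    | add f g hf hg => rw [add_smul, map_add, map_add, hf, hg, add_comp, add_smul]
    | monomial n a ih =>
      have : (C a * X ^ (n + 1) : ℂ[X]) • w = (X : ℂ[X]) • (C a * X ^ n : ℂ[X]) • w := by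
        rw [smul_smul]; congr 1; ring
      rw [this, ρ.act_del, ih, smul_smul]
      congr 1
      simp; ring
  rw [hf, hg, smul_smul]

/-- `Lᵢ _λ v`, as an element of the `ℂ[∂, λ]`-module `M[λ]`. -/
def field (i : ℕ) : M →ₗ[ℂ] PolynomialModule ℂ[X] M :=
  (PolynomialModule.coeffLinearEquiv ℂ[X] ℂ).symm.toLinearMap ∘ₗ
    (PolynomialModule.coeffLinearEquiv ℂ ℂ).toLinearMap ∘ₗ ρ.act (Finsupp.single i 1)

lemma coeff_field (i : ℕ) (v : M) :
    (field ρ i v).coeff = (ρ.act (Finsupp.single i 1) v).coeff := rfl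

lemma eval_field (i : ℕ) (v : M) (l : ℂ) :
    PolynomialModule.eval (C l) (field ρ i v) = lamEval l (ρ.act (Finsupp.single i 1) v) := by
  rw [eval_C_apply, lamEval_apply, coeff_field]

lemma field_smul (i : ℕ) (g : ℂ[X]) (v : M) : field ρ i (g • v) = shift g • field ρ i v := by
  refine polynomialModule_ext_eval fun l => ?_
  rw [PolynomialModule.eval_smul, eval_field, eval_field, lamEval_act_single, shift_eval, one_comp,
    one_mul]

/-- The commutation relation of the fields. -/
lemma eval_field_comm (i j : ℕ) (v : M) (l m : ℂ) :
    PolynomialModule.eval (C l) (field ρ i (PolynomialModule.eval (C m) (field ρ j v))) -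
      PolynomialModule.eval (C m) (field ρ j (PolynomialModule.eval (C l) (field ρ i v))) =
    ((j + p) * l - (i + p) * m) • PolynomialModule.eval (C (l + m)) (field ρ (i + j) v) := by
  have h := ρ.bracket_act (Finsupp.single i 1) (Finsupp.single j 1) v l m
  simp only [eval_field]
  rw [← h, lamEval_block, ← one_smul ℂ[X] v, lamEval_act_single, one_smul, ← C_smul]
  congr 1
  simp only [one_comp, mul_one, add_comp, mul_comp, C_comp, X_comp, map_sub, map_mul, map_add]
  simp only [map_natCast, map_ofNat]
  ring

/-- The coefficient of `λⁿ` in `Lᵢ _λ`. -/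
def mode (i n : ℕ) : M →ₗ[ℂ] M :=
  Finsupp.lapply n ∘ₗ (PolynomialModule.coeffLinearEquiv ℂ[X] ℂ).toLinearMap ∘ₗ field ρ i

lemma mode_apply (i n : ℕ) (v : M) : mode ρ i n v = (field ρ i v).coeff n := rfl

lemma field_eq_zero_iff {i : ℕ} {v : M} : field ρ i v = 0 ↔ ∀ n, mode ρ i n v = 0 := by
  rw [← PolynomialModule.coeff_eq_zero, DFunLike.ext_iff]; rfl

lemma eval_C_zero (x : PolynomialModule ℂ[X] M) : PolynomialModule.eval (C 0) x = x.coeff 0 := by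
  rw [eval_C_apply, Finsupp.sum, Finset.sum_eq_single 0]
  · simp
  · intro n _ hn; simp [hn]
  · intro h; simpa using h

/-- The value of `Lⱼ _λ` at `λ = 0`, a `ℂ[∂]`-linear map. -/
def zeroMode (j : ℕ) : M →ₗ[ℂ[X]] M where
  toFun v := mode ρ j 0 v
  map_add' := map_add _
  map_smul' g v := by
    rw [mode_apply, mode_apply, field_smul, ← eval_C_zero, PolynomialModule.eval_smul, eval_C_zero,
      shift_eval, C_0, add_zero, comp_X, RingHom.id_apply]

lemma zeroMode_apply (j : ℕ) (v : M) : zeroMode ρ j v = mode ρ j 0 v := rfl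

lemma field_zeroMode (i j : ℕ) (v : M) :
    field ρ i (zeroMode ρ j v) = PolynomialModule.map ℂ[X] (zeroMode ρ j) (field ρ i v) +
      (C (C ((j : ℂ) + p)) * X : ℂ[X][X]) • field ρ (i + j) v := by
  refine polynomialModule_ext_eval fun l => ?_
  have h := eval_field_comm ρ i j v l 0
  rw [eval_C_zero, eval_C_zero, sub_eq_iff_eq_add', mul_zero, sub_zero, add_zero, ← mode_apply,
    ← mode_apply, ← zeroMode_apply, ← zeroMode_apply] at h
  rw [h, map_add, PolynomialModule.eval_map', PolynomialModule.eval_smul, ← C_smul]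
  congr 2
  simp

/-- The coefficient of `λ` in `((j + p)λ - pμ) Lⱼ _{λ+μ}` is `(j + p) Lⱼ _μ - pμ (d/dμ) Lⱼ _μ`; the
coefficient of `μⁿ` in this is `(j + p - pn) Lⱼ(n)`. -/
lemma mode_zero_one_mode (j n : ℕ) (v : M) :
    mode ρ 0 1 (mode ρ j n v) = mode ρ j n (mode ρ 0 1 v) + (j + p - p * n) • mode ρ j n v := by
  set y := field ρ j v with hy
  have h1 : ∀ m : ℂ, mode ρ 0 1 (PolynomialModule.eval (C m) y) =
      PolynomialModule.eval (C m) (field ρ j (mode ρ 0 1 v)) +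
      ((j + p) • (y.coeff.sum fun n w => m ^ n • w) -
        p • (y.coeff.sum fun n w => m ^ n • (n • w))) := by
    intro m
    let Lm : M →ₗ[ℂ] M :=
      ((PolynomialModule.eval (C m : ℂ[X])).restrictScalars ℂ) ∘ₗ field ρ j
    have hL : ∀ w, PolynomialModule.eval (C m) (field ρ j w) = Lm w := fun _ => rfl
    -- `z` is the polynomial `Lⱼ _m (L₀ _λ v)` in `λ`, for fixed `m`; `Lm` is merely `ℂ`-linear and
    -- is applied coefficientwise.
    let z : PolynomialModule ℂ[X] M :=
      .ofCoeff ℂ[X] ((field ρ 0 v).coeff.mapRange Lm (map_zero _))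
    have hz : ∀ l, PolynomialModule.eval (C l) z =
        Lm (PolynomialModule.eval (C l) (field ρ 0 v)) := by
      intro l
      rw [eval_C_apply, eval_C_apply, PolynomialModule.coeff_ofCoeff,
        Finsupp.sum_mapRange_index (by simp), Finsupp.sum, Finsupp.sum, map_sum]
      simp only [map_smul]
    have key : field ρ 0 (PolynomialModule.eval (C m) y) = z +
        (C (C ((j : ℂ) + p)) * X - C (C (p * m)) : ℂ[X][X]) •
          PolynomialModule.comp (X + C (C m)) y := by
      refine polynomialModule_ext_eval fun l => ?_
      have h := eval_field_comm ρ 0 j v l m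
      rw [hL (PolynomialModule.eval _ _), ← hz, sub_eq_iff_eq_add', zero_add, ← hy] at h
      rw [h, LinearMap.map_add, PolynomialModule.eval_smul, PolynomialModule.comp_eval, ← C_smul]
      congr 2
      · simp
      · simp
    have h1 := congrArg (fun x => PolynomialModule.coeff x 1) key
    simp only [sub_smul, mul_smul, PolynomialModule.coeff_add, Finsupp.add_apply] at h1
    have hsub : ∀ a b : PolynomialModule ℂ[X] M, (a - b).coeff 1 = a.coeff 1 - b.coeff 1 := by
      intro a b
      rw [eq_sub_iff_add_eq, ← Finsupp.add_apply, ← PolynomialModule.coeff_add, sub_add_cancel]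
    obtain ⟨hc0, hc1⟩ := coeff_comp_zero_one (C m) y
    rw [hsub, coeff_C_smul, coeff_C_smul, coeff_X_smul_succ, hc0, C_mul, mul_smul, hc1] at h1
    rw [mode_apply, h1, C_smul, C_smul]
    simp only [← C_pow, C_smul]
    rfl
  set S := y.coeff.support ∪ (field ρ j (mode ρ 0 1 v)).coeff.support with hS
  by_cases hn : n ∈ S
  · rw [← sub_eq_zero]
    refine eq_zero_of_forall_sum_pow_smul (s := S) (f := fun n => mode ρ 0 1 (mode ρ j n v) -
      (mode ρ j n (mode ρ 0 1 v) + (j + p - p * n) • mode ρ j n v)) (fun m => ?_) hn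
    have := h1 m
    rw [eval_C_apply, eval_C_apply,
      Finsupp.sum_of_support_subset y.coeff Finset.subset_union_left _ (by simp),
      Finsupp.sum_of_support_subset _ Finset.subset_union_right _ (by simp),
      Finsupp.sum_of_support_subset y.coeff Finset.subset_union_left _ (by simp), ← hS,
      Finset.smul_sum, Finset.smul_sum, ← Finset.sum_sub_distrib, ← Finset.sum_add_distrib,
      map_sum, ← sub_eq_zero, ← Finset.sum_sub_distrib] at this
    rw [← this]
    refine Finset.sum_congr rfl fun n _ => ?_
    rw [map_smul, mode_apply _ j, mode_apply _ j, ← hy, ← Nat.cast_smul_eq_nsmul ℂ]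
    module
  · rw [hS, Finset.mem_union, not_or, Finsupp.notMem_support_iff, Finsupp.notMem_support_iff,
      ← mode_apply, ← mode_apply] at hn
    rw [hn.1, hn.2, map_zero, smul_zero, add_zero]

end BlockModule

lemma shift_eq_taylor (f : ℂ[X]) : shift f = taylor X (f.map C) := by
  induction f using Polynomial.induction_on' with
  | add f g hf hg => simp [hf, hg]
  | monomial n a =>
    simp [shift, aeval_monomial, IsScalarTower.algebraMap_apply ℂ ℂ[X] ℂ[X][X], taylor_monomial,
      add_comm]

lemma natDegree_shift (f : ℂ[X]) : (shift f).natDegree = f.natDegree := by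
  rw [shift_eq_taylor, natDegree_taylor, natDegree_map_eq_of_injective C_injective]

lemma coeff_shift_natDegree (f : ℂ[X]) : (shift f).coeff f.natDegree = C f.leadingCoeff := by
  rw [← natDegree_shift, coeff_natDegree, shift_eq_taylor, leadingCoeff_taylor,
    leadingCoeff_map_of_injective C_injective]

/-! ### Conformal submodules and torsion-freeness -/

section BlockModule

variable {p : ℂ} {M : Type*} [AddCommGroup M] [Module ℂ M] [Module ℂ[X] M] [IsScalarTower ℂ ℂ[X] M]
  (ρ : ConformalModule (block p) M)

/-- By sesquilinearity `(f(∂)Lᵢ) _λ = f(-λ) Lᵢ _λ`, so only the modes of the generators matter. -/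
lemma isSubmodule_of_mode_mem (N : Submodule ℂ[X] M)
    (h : ∀ i n, ∀ v ∈ N, mode ρ i n v ∈ N) : ρ.IsSubmodule N := by
  intro a v hv k
  induction a using Finsupp.induction_linear with
  | zero => simp
  | add a b ha hb =>
    rw [map_add, LinearMap.add_apply, PolynomialModule.coeff_add, Finsupp.add_apply]
    exact N.add_mem ha hb
  | single i f =>
    have key : PolynomialModule.ofCoeff ℂ[X] (ρ.act (Finsupp.single i f) v).coeff =
        (aeval (-X : ℂ[X][X]) f) • field ρ i v := by
      refine polynomialModule_ext_eval fun l => ?_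
      have hf : (aeval (-X : ℂ[X][X]) f).eval (C l) = f.comp (-C l) := by
        induction f using Polynomial.induction_on' with
        | add f g hf hg => simp [hf, hg]
        | monomial n a =>
          simp [aeval_monomial, IsScalarTower.algebraMap_apply ℂ ℂ[X] ℂ[X][X]]
      rw [PolynomialModule.eval_smul, hf, eval_field, eval_C_apply,
        PolynomialModule.coeff_ofCoeff, ← lamEval_apply, ← one_smul ℂ[X] v, lamEval_act_single]
      simp
    have hk := congrArg (fun x => PolynomialModule.coeff x k) key
    simp only [PolynomialModule.smul_apply] at hk
    rw [hk]
    exact N.sum_mem fun x _ => N.smul_mem _ (h i _ v hv)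

lemma act_eq_zero {v : M} (h : ∀ i, field ρ i v = 0) (a : ℕ →₀ ℂ[X]) : ρ.act a v = 0 := by
  induction a using Finsupp.induction_linear with
  | zero => simp
  | add a b ha hb => rw [map_add, LinearMap.add_apply, ha, hb, add_zero]
  | single i f =>
    rw [← PolynomialModule.coeff_eq_zero]
    refine finsupp_eq_zero_of_forall_sum_pow_smul _ fun l => ?_
    rw [← lamEval_apply, ← one_smul ℂ[X] v, lamEval_act_single, ← eval_field, h, map_zero,
      smul_zero]

/-- The vectors that are killed by all `Lₖ` with `k ≥ n`. -/
def annihilated (n : ℕ) : Submodule ℂ[X] M where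
  carrier := {v | ∀ k, n ≤ k → field ρ k v = 0}
  zero_mem' k _ := map_zero _
  add_mem' {v w} hv hw k hk := by rw [map_add, hv k hk, hw k hk, add_zero]
  smul_mem' g v hv k hk := by rw [field_smul, hv k hk, smul_zero]

/-- `[Lₖ _λ, Lᵢ _μ]` is a multiple of `Lₖ₊ᵢ`, and `k + i ≥ n` whenever `k ≥ n`. So `Lₖ _λ` kills `Lᵢ
_μ v` for all `μ`, hence each of its coefficients. -/
lemma isSubmodule_annihilated (n : ℕ) : ρ.IsSubmodule (annihilated ρ n) := by
  refine isSubmodule_of_mode_mem ρ _ fun i m v hv k hk => ?_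
  refine polynomialModule_ext_eval fun l => ?_
  let Lk : M →ₗ[ℂ] M :=
    ((PolynomialModule.eval (C l : ℂ[X])).restrictScalars ℂ) ∘ₗ field ρ k
  have hL : ∀ w, PolynomialModule.eval (C l) (field ρ k w) = Lk w := fun _ => rfl
  rw [map_zero, hL]
  by_cases hm : m ∈ (field ρ i v).coeff.support
  · refine eq_zero_of_forall_sum_pow_smul (f := fun m => Lk (mode ρ i m v)) (fun c => ?_) hm
    have h := eval_field_comm ρ k i v l c
    rw [hv k hk, hv (k + i) (by omega), map_zero, map_zero, map_zero, map_zero, smul_zero,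
      sub_zero, hL, eval_C_apply, Finsupp.sum, map_sum] at h
    rw [← h]
    exact Finset.sum_congr rfl fun n _ => (map_smul _ _ _).symm
  · rw [Finsupp.notMem_support_iff, ← mode_apply] at hm
    rw [hm, map_zero]

variable {ρ}

lemma annihilated_eq_top (hirr : ρ.IsIrreducible) {n : ℕ} {v : M} (hv : v ≠ 0)
    (h : ∀ k, n ≤ k → field ρ k v = 0) : annihilated ρ n = ⊤ := by
  refine (hirr.2 _ (isSubmodule_annihilated ρ n)).resolve_left fun hb => hv ?_
  rw [← Submodule.mem_bot ℂ[X], ← hb]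
  exact h

lemma field_eq_zero_of_irreducible (hirr : ρ.IsIrreducible) {n : ℕ} {v : M} (hv : v ≠ 0)
    (h : ∀ k, n ≤ k → field ρ k v = 0) {k : ℕ} (hk : n ≤ k) (w : M) : field ρ k w = 0 := by
  have : w ∈ annihilated ρ n := by rw [annihilated_eq_top hirr hv h]; trivial
  exact this k hk

/-- As a polynomial in `λ`, `q(∂ + λ)` has a nonzero complex number as leading coefficient, which
cannot kill the top coefficient of `x` even if `M` has torsion. -/
lemma eq_zero_of_smul_shift {q : ℂ[X]} (hq : q ≠ 0) {x : PolynomialModule ℂ[X] M}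
    (h : shift q • x = 0) : x = 0 := by
  by_contra hx
  obtain ⟨d, hd, hd'⟩ := exists_top_coeff hx
  have := (coeff_smul_of_degree_le (natDegree_shift q).le hd').2
  rw [h, coeff_shift_natDegree, C_smul] at this
  exact smul_ne_zero (leadingCoeff_ne_zero.2 hq) hd this.symm

/-- If `q v = 0` then `q(∂ + λ) Lᵢ _λ v = 0`, so all fields kill `v`. A nonzero such `v` would make
the whole action zero by irreducibility. -/
lemma isTorsionFree (hirr : ρ.IsIrreducible) (hnt : ρ.IsNontrivial) :
    Module.IsTorsionFree ℂ[X] M := by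
  rw [Module.isTorsionFree_iff_smul_eq_zero]
  intro q v h
  by_contra hcon
  rw [not_or] at hcon
  obtain ⟨a, w, haw⟩ := hnt
  refine haw (act_eq_zero ρ (fun i => ?_) a)
  refine field_eq_zero_of_irreducible (n := 0) hirr hcon.2 (fun k _ => ?_) (Nat.zero_le i) w
  exact eq_zero_of_smul_shift hcon.1 (by rw [← field_smul, h, map_zero])

end BlockModule

/-! ### The fibres `M / (∂ - s)M` -/

section Quotient

variable {M : Type*} [AddCommGroup M] [Module ℂ[X] M]

variable (M) in
/-- The submodule `(∂ - s) M`. -/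
def fiberKer (s : ℂ) : Submodule ℂ[X] M := 
  LinearMap.range (LinearMap.lsmul ℂ[X] M (X - C s))

lemma mem_fiberKer {s : ℂ} {v : M} : v ∈ fiberKer M s ↔ ∃ w : M, (X - C s : ℂ[X]) • w = v := Iff.rfl

/-- Nakayama: `N = (∂ - s)N` yields `r ≡ 1` modulo `∂ - s` with `rN = 0`. Then `r ≠ 0`, and
torsion-freeness applies. -/
lemma eq_bot_of_le_smul [Module.Finite ℂ[X] M] [Module.IsTorsionFree ℂ[X] M] {s : ℂ}
    (N : Submodule ℂ[X] M) (h : ∀ v ∈ N, ∃ w ∈ N, (X - C s : ℂ[X]) • w = v) : N = ⊥ := by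
  obtain ⟨r, hr, hr'⟩ := Submodule.exists_sub_one_mem_and_smul_eq_zero_of_fg_of_le_smul
    (Ideal.span {(X - C s : ℂ[X])}) N (IsNoetherian.noetherian N) (fun v hv => by
      obtain ⟨w, hw, rfl⟩ := h v hv
      exact Submodule.smul_mem_smul (Ideal.mem_span_singleton_self _) hw)
  have hr0 : r ≠ 0 := by
    rintro rfl
    rw [Ideal.mem_span_singleton, dvd_iff_isRoot] at hr
    simp at hr
  rw [Submodule.eq_bot_iff]
  intro v hv
  exact (smul_eq_zero.1 (hr' v hv)).resolve_left hr0

variable [Module ℂ M] [IsScalarTower ℂ ℂ[X] M]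

lemma finite_quotient_fiberKer [Module.Finite ℂ[X] M] (s : ℂ) :
    Module.Finite ℂ (M ⧸ fiberKer M s) := by
  obtain ⟨S, hS⟩ := (Module.Finite.fg_top : (⊤ : Submodule ℂ[X] (M ⧸ fiberKer M s)).FG)
  refine ⟨⟨S, ?_⟩⟩
  rw [eq_top_iff]
  rintro x -
  have hx : x ∈ Submodule.span ℂ[X] (S : Set (M ⧸ fiberKer M s)) := by rw [hS]; trivial
  induction hx using Submodule.span_induction with
  | mem x hx => exact Submodule.subset_span hx
  | zero => exact Submodule.zero_mem _
  | add x y _ _ hx hy => exact Submodule.add_mem _ hx hy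
  | smul g x _ hx =>
    have : g • x = g.eval s • x := by
      obtain ⟨v, rfl⟩ := Submodule.Quotient.mk_surjective _ x
      rw [← C_smul, ← Submodule.Quotient.mk_smul, ← Submodule.Quotient.mk_smul,
        Submodule.Quotient.eq, ← sub_smul]
      obtain ⟨q, hq⟩ := X_sub_C_dvd_sub_C_eval (p := g) (a := s)
      rw [hq, mul_smul]
      exact mem_fiberKer.2 ⟨_, rfl⟩
    rw [this]
    exact Submodule.smul_mem _ _ hx

end Quotient

/-! ### Schur's lemma and the zero mode of `L₀` -/

section Schur

variable {p : ℂ} {M : Type*} [AddCommGroup M] [Module ℂ M] [Module ℂ[X] M] [IsScalarTower ℂ ℂ[X] M]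
  {ρ : ConformalModule (block p) M}

/-- `T` acts on the nonzero finite-dimensional fibre `M / ∂M` and has an eigenvalue `c` there. So `T
- c` is not surjective on the fibre, nor on `M`; its range is a conformal submodule, hence zero. -/
lemma exists_eq_smul_of_commute (hirr : ρ.IsIrreducible) [Module.Finite ℂ[X] M]
    [Module.IsTorsionFree ℂ[X] M] (T : M →ₗ[ℂ[X]] M)
    (hT : ∀ i v, field ρ i (T v) = PolynomialModule.map ℂ[X] T (field ρ i v)) :
    ∃ c : ℂ, ∀ v, T v = c • v := by
  have := hirr.1
  have := finite_quotient_fiberKer (M := M) 0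
  have hne : fiberKer M 0 ≠ ⊤ := by
    intro h
    have := eq_bot_of_le_smul (s := 0) (⊤ : Submodule ℂ[X] M) (fun v _ => by
      obtain ⟨w, hw⟩ := mem_fiberKer.1 (h ▸ Submodule.mem_top : v ∈ fiberKer M 0)
      exact ⟨w, trivial, hw⟩)
    exact bot_ne_top this.symm
  have := Submodule.Quotient.nontrivial_iff.2 hne
  let T' : (M ⧸ fiberKer M 0) →ₗ[ℂ[X]] (M ⧸ fiberKer M 0) := (fiberKer M 0).mapQ _ T (by
    intro v hv
    obtain ⟨w, rfl⟩ := mem_fiberKer.1 hv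
    exact mem_fiberKer.2 ⟨T w, (map_smul _ _ _).symm⟩)
  let T'' : Module.End ℂ (M ⧸ fiberKer M 0) := T'.restrictScalars ℂ
  obtain ⟨c, hc⟩ := T''.exists_eigenvalue
  refine ⟨c, ?_⟩
  let U : M →ₗ[ℂ[X]] M := T - c • LinearMap.id
  have hU : ∀ v, U v = T v - c • v := fun _ => rfl
  have hsub : ρ.IsSubmodule (LinearMap.range U) := by
    refine isSubmodule_of_mode_mem ρ _ fun i n v hv => ?_
    obtain ⟨w, rfl⟩ := hv
    refine ⟨mode ρ i n w, ?_⟩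
    rw [hU, hU, map_sub, map_smul, mode_apply _ _ _ (T w), hT, coeff_map_polynomialModule]
    rfl
  rcases hirr.2 _ hsub with h | h
  · intro v
    have : U v = 0 := by rw [LinearMap.range_eq_bot.1 h]; rfl
    rwa [hU, sub_eq_zero] at this
  · exfalso
    have hsurj : Function.Surjective
        (T'' - c • 1 : Module.End ℂ (M ⧸ fiberKer M 0)) := by
      intro x
      obtain ⟨v, rfl⟩ := Submodule.Quotient.mk_surjective _ x
      obtain ⟨w, rfl⟩ := LinearMap.range_eq_top.1 h v
      exact ⟨Submodule.Quotient.mk w, rfl⟩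
    have hinj := (LinearMap.injective_iff_surjective).2 hsurj
    obtain ⟨x, hx⟩ := hc.exists_hasEigenvector
    refine hx.2 (hinj ?_)
    rw [map_zero, LinearMap.sub_apply, hx.apply_eq_smul, LinearMap.smul_apply, Module.End.one_apply,
      sub_self]

/-- `L₀(0)` and `p∂` have the same commutator `pλ Lᵢ _λ` with every field, so their difference is a
scalar by Schur's lemma. -/
lemma exists_zeroMode_zero (hp : p ≠ 0) (hirr : ρ.IsIrreducible) [Module.Finite ℂ[X] M]
    [Module.IsTorsionFree ℂ[X] M] :
    ∃ α : ℂ, ∀ v, zeroMode ρ 0 v = p • (X + C α : ℂ[X]) • v := by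
  obtain ⟨c, hc⟩ := exists_eq_smul_of_commute hirr
    (zeroMode ρ 0 - (C p * X : ℂ[X]) • LinearMap.id) (by
      intro i v
      rw [LinearMap.sub_apply, LinearMap.smul_apply, LinearMap.id_apply, map_sub, field_zeroMode,
        field_smul, add_zero]
      have : (PolynomialModule.map ℂ[X] (zeroMode ρ 0 - (C p * X : ℂ[X]) • LinearMap.id))
          (field ρ i v) = PolynomialModule.map ℂ[X] (zeroMode ρ 0) (field ρ i v) -
            (C (C p * X) : ℂ[X][X]) • field ρ i v := by
        refine polynomialModule_ext_eval fun l => ?_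
        rw [map_sub, PolynomialModule.eval_smul, PolynomialModule.eval_map',
          PolynomialModule.eval_map', eval_C]
        rfl
      rw [this]
      have h2 : shift (C p * X) = C (C p * X) + C (C p) * X := by
        simp [shift, IsScalarTower.algebraMap_apply ℂ ℂ[X] ℂ[X][X], mul_add]
      rw [h2, add_smul]
      simp)
  refine ⟨c / p, fun v => ?_⟩
  have h := hc v
  rw [LinearMap.sub_apply, LinearMap.smul_apply, LinearMap.id_apply, sub_eq_iff_eq_add] at h
  rw [h, ← C_smul, ← C_smul, smul_smul, ← add_smul]
  congr 1
  rw [mul_add, ← C_mul, mul_div_cancel₀ _ hp, add_comm]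

end Schur

/-! ### Generalised eigenspaces -/

section WeightSpaces

variable {M : Type*} [AddCommGroup M] [Module ℂ M] {D : Module.End ℂ M}

lemma map_mem_maxGenEigenspace {f : M →ₗ[ℂ] M} {w : ℂ} (hf : ∀ v, D (f v) = f (D v) + w • f v)
    {c : ℂ} {v : M} (hv : v ∈ D.maxGenEigenspace c) : f v ∈ D.maxGenEigenspace (c + w) := by
  rw [Module.End.mem_maxGenEigenspace] at hv ⊢
  obtain ⟨k, hk⟩ := hv
  refine ⟨k, ?_⟩
  have key : ∀ (k : ℕ) (v : M), ((D - (c + w) • 1) ^ k) (f v) = f (((D - c • 1) ^ k) v) := by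
    intro k
    induction k with
    | zero => simp
    | succ k ih =>
      intro v
      rw [pow_succ, pow_succ, Module.End.mul_apply, Module.End.mul_apply, ← ih]
      congr 1
      simp only [LinearMap.sub_apply, LinearMap.smul_apply, Module.End.one_apply, map_sub, hf,
        map_smul]
      module
  rw [key, hk, map_zero]

lemma mem_iSup_maxGenEigenspace_of_finite {W : Submodule ℂ M} [FiniteDimensional ℂ W]
    (hW : ∀ v ∈ W, D v ∈ W) {v : M} (hv : v ∈ W) : v ∈ ⨆ c, D.maxGenEigenspace c := by
  let DW : Module.End ℂ W := D.restrict hW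
  have h : (⟨v, hv⟩ : W) ∈ ⨆ c, DW.maxGenEigenspace c := by
    rw [Module.End.iSup_maxGenEigenspace_eq_top]; trivial
  have h2 : (⨆ c, DW.maxGenEigenspace c).map W.subtype ≤
      ⨆ c, D.maxGenEigenspace c := by
    rw [Submodule.map_iSup]
    refine iSup_mono fun c => ?_
    rintro _ ⟨w, hw, rfl⟩
    rw [SetLike.mem_coe, Module.End.mem_maxGenEigenspace] at hw
    obtain ⟨k, hk⟩ := hw
    rw [Module.End.mem_maxGenEigenspace]
    refine ⟨k, ?_⟩
    have key : ∀ (k : ℕ) (w : W), ((D - c • 1) ^ k) (w : M) =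
        (((DW - c • 1) ^ k) w : W) := by
      intro k
      induction k with
      | zero => simp
      | succ k ih =>
        intro w
        rw [pow_succ, pow_succ, Module.End.mul_apply, Module.End.mul_apply, ← ih]
        rfl
    rw [Submodule.subtype_apply, key, hk]; rfl
  exact h2 ⟨_, h, rfl⟩

end WeightSpaces

/-! ### Local finiteness of the weight operator -/

section WeightOperator

variable {p : ℂ} {M : Type*} [AddCommGroup M] [Module ℂ M] [Module ℂ[X] M] [IsScalarTower ℂ ℂ[X] M]
  (ρ : ConformalModule (block p) M)

/-- The operator `p⁻¹ L₀₍₁₎`, whose generalised eigenspaces grade a finite irreducible module. -/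
def weightOp : Module.End ℂ M := p⁻¹ • mode ρ 0 1

lemma weightOp_mode (hp : p ≠ 0) (j n : ℕ) (v : M) :
    weightOp ρ (mode ρ j n v) = mode ρ j n (weightOp ρ v) + (j / p + 1 - n : ℂ) • mode ρ j n v := by
  simp only [weightOp, LinearMap.smul_apply, mode_zero_one_mode, map_smul, smul_add, smul_smul]
  congr 2
  field_simp

lemma shift_X_add_C (α : ℂ) : shift (X + C α) = C (X + C α) + X := by
  simp [shift, IsScalarTower.algebraMap_apply ℂ ℂ[X] ℂ[X][X]]
  ring

lemma mode_X_add_C_smul_succ (i n : ℕ) (α : ℂ) (v : M) :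
    mode ρ i (n + 1) ((X + C α : ℂ[X]) • v) =
      (X + C α : ℂ[X]) • mode ρ i (n + 1) v + mode ρ i n v := by
  rw [mode_apply, field_smul, shift_X_add_C, add_smul, PolynomialModule.coeff_add,
    Finsupp.add_apply, coeff_C_smul, coeff_X_smul_succ]
  rfl

lemma weightOp_smul (hp : p ≠ 0) {α : ℂ}
    (hα : ∀ v, zeroMode ρ 0 v = p • (X + C α : ℂ[X]) • v) (v : M) :
    weightOp ρ ((X + C α : ℂ[X]) • v) =
      (X + C α : ℂ[X]) • weightOp ρ v + (X + C α : ℂ[X]) • v := by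
  rw [weightOp, LinearMap.smul_apply, LinearMap.smul_apply, mode_X_add_C_smul_succ,
    ← zeroMode_apply, hα, smul_add, smul_smul, inv_mul_cancel₀ hp, one_smul, smul_comm]

/-- The vectors `v` such that the degree of `L₀ _λ v` is at most `d`. -/
def boundedDegree (d : ℕ) : Submodule ℂ M where
  carrier := {v | ∀ n, d < n → mode ρ 0 n v = 0}
  zero_mem' n _ := map_zero _
  add_mem' {v w} hv hw n hn := by rw [map_add, hv n hn, hw n hn, add_zero]
  smul_mem' c v hv n hn := by rw [map_smul, hv n hn, smul_zero]

lemma weightOp_mem_boundedDegree (hp : p ≠ 0) {d : ℕ} {v : M} (hv : v ∈ boundedDegree ρ d) :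
    weightOp ρ v ∈ boundedDegree ρ d := by
  intro n hn
  have := weightOp_mode ρ hp 0 n v
  rwa [hv n hn, map_zero, smul_zero, add_zero, eq_comm] at this

/-- The vectors `v` such that the coefficients of `L₀ _λ v` lie in `(∂ - s) M`. -/
def vanishingAt (s : ℂ) : Submodule ℂ[X] M where
  carrier := {v | ∀ n, mode ρ 0 n v ∈ fiberKer M s}
  zero_mem' n := by rw [map_zero]; exact Submodule.zero_mem _
  add_mem' {v w} hv hw n := by rw [map_add]; exact Submodule.add_mem _ (hv n) (hw n)
  smul_mem' g v hv n := by
    rw [mode_apply, field_smul, PolynomialModule.smul_apply]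
    exact Submodule.sum_mem _ fun x _ => Submodule.smul_mem _ _ (hv _)

/-- With `s = 1 - α` one has `∂ + α = (∂ - s) + 1`. So `L₀(0)v ∈ (∂ - s)M` forces `v = (∂ - s)w`,
and `L₀(n+1)v = (∂ - s)L₀(n+1)w + L₀(n)w` passes the condition on to `w`. Nakayama finishes. -/
lemma vanishingAt_eq_bot [Module.Finite ℂ[X] M] [Module.IsTorsionFree ℂ[X] M] (hp : p ≠ 0) {α : ℂ}
    (hα : ∀ v, zeroMode ρ 0 v = p • (X + C α : ℂ[X]) • v) : vanishingAt ρ (1 - α) = ⊥ := by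
  refine eq_bot_of_le_smul (s := 1 - α) _ fun v hv => ?_
  have hX : (X + C α : ℂ[X]) = (X - C (1 - α)) + 1 := by rw [C_sub, C_1]; ring
  have h0 : v ∈ fiberKer M (1 - α) := by
    have := hv 0
    rw [← zeroMode_apply, hα, hX, add_smul, one_smul, ← C_smul] at this
    have h2 := Submodule.smul_mem _ (C p⁻¹) this
    rw [smul_smul, ← C_mul, inv_mul_cancel₀ hp, C_1, one_smul] at h2
    exact (Submodule.add_mem_iff_right _ (mem_fiberKer.2 ⟨v, rfl⟩)).1 h2
  obtain ⟨w, rfl⟩ := mem_fiberKer.1 h0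
  refine ⟨w, fun n => ?_, rfl⟩
  have := hv (n + 1)
  have hXs : (X - C (1 - α) : ℂ[X]) = X + C (-(1 - α)) := by rw [C_neg, sub_eq_add_neg]
  rw [hXs, mode_X_add_C_smul_succ, ← hXs] at this
  exact (Submodule.add_mem_iff_right _ (mem_fiberKer.2 ⟨_, rfl⟩)).1 this

/-- Reducing the `d + 1` coefficients of `L₀ _λ v` to the fibre at `1 - α` is injective, by
`vanishingAt_eq_bot`, and the fibre is finite-dimensional. -/
lemma finiteDimensional_boundedDegree [Module.Finite ℂ[X] M] [Module.IsTorsionFree ℂ[X] M]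
    (hp : p ≠ 0) {α : ℂ}
    (hα : ∀ v, zeroMode ρ 0 v = p • (X + C α : ℂ[X]) • v) (d : ℕ) :
    FiniteDimensional ℂ (boundedDegree ρ d) := by
  have := finite_quotient_fiberKer (M := M) (1 - α)
  let f : boundedDegree ρ d →ₗ[ℂ] (Fin (d + 1) → M ⧸ fiberKer M (1 - α)) :=
    LinearMap.pi fun n => ((fiberKer M (1 - α)).mkQ.restrictScalars ℂ) ∘ₗ mode ρ 0 n ∘ₗ
      (boundedDegree ρ d).subtype
  refine FiniteDimensional.of_injective f ?_
  rw [injective_iff_map_eq_zero]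
  intro v hv
  have : (v : M) ∈ vanishingAt ρ (1 - α) := by
    intro n
    by_cases hn : d < n
    · rw [v.2 n hn]; exact Submodule.zero_mem _
    · have := congrFun hv ⟨n, by omega⟩
      exact (Submodule.Quotient.mk_eq_zero _).1 this
  rw [vanishingAt_eq_bot ρ hp hα, Submodule.mem_bot] at this
  exact Subtype.ext this

/-- A finite module is generated by finitely many weight spaces. -/
lemma exists_finset_span_weight [Module.Finite ℂ[X] M] [Module.IsTorsionFree ℂ[X] M]
    (hp : p ≠ 0) {α : ℂ} (hα : ∀ v, zeroMode ρ 0 v = p • (X + C α : ℂ[X]) • v) :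
    ∃ F : Finset ℂ, Submodule.span ℂ[X]
      (⋃ c ∈ F, ((weightOp ρ).maxGenEigenspace c : Set M)) = ⊤ := by
  obtain ⟨S, hS⟩ := (Module.Finite.fg_top : (⊤ : Submodule ℂ[X] M).FG)
  have hmem : ∀ v : M, ∃ F : Finset ℂ, v ∈ ⨆ c ∈ F, (weightOp ρ).maxGenEigenspace c := by
    intro v
    -- With `d` the degree of `L₀ _λ v`, `v` lies in a finite-dimensional `D`-stable space.
    have := finiteDimensional_boundedDegree ρ hp hα ((field ρ 0 v).coeff.support.sup id)
    have hv : v ∈ boundedDegree ρ ((field ρ 0 v).coeff.support.sup id) := by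
      intro n hn
      by_contra h
      exact absurd (Finset.le_sup (f := id) (Finsupp.mem_support_iff.2 h)) (by simpa using hn)
    exact Submodule.mem_iSup_iff_exists_finset.1 (mem_iSup_maxGenEigenspace_of_finite
      (fun w hw => weightOp_mem_boundedDegree ρ hp hw) hv)
  choose F hF using hmem
  classical
  refine ⟨S.biUnion F, ?_⟩
  rw [eq_top_iff, ← hS, Submodule.span_le]
  intro v hv
  have h1 : (⨆ c ∈ F v, (weightOp ρ).maxGenEigenspace c) ≤ (Submodule.span ℂ[X]
      (⋃ c ∈ S.biUnion F, ((weightOp ρ).maxGenEigenspace c : Set M))).restrictScalars ℂ := by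
    refine iSup₂_le fun c hc w hw => Submodule.subset_span ?_
    exact Set.mem_biUnion (Finset.mem_coe.2 (Finset.mem_biUnion.2 ⟨v, hv, hc⟩)) hw
  exact h1 (hF v)

end WeightOperator

/-! ### Weights of finitely generated graded modules -/

section WeightSums

variable {M : Type*} [AddCommGroup M] [Module ℂ M] {D : Module.End ℂ M}

lemma sum_weight_eq_zero {c : ℂ} {ι : Type*} (s : Finset ι) (φ : ι → ℕ) (y : ι → M)
    (hy : ∀ i ∈ s, y i ∈ D.maxGenEigenspace (c + φ i)) (h : ∑ i ∈ s, y i = 0) (n : ℕ) :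
    ∑ i ∈ s with φ i = n, y i = 0 := by
  have hind : iSupIndep fun n : ℕ => D.maxGenEigenspace (c + n) :=
    D.independent_maxGenEigenspace.comp (f := fun n : ℕ => c + (n : ℂ)) fun a b hab => by
      simpa using hab
  by_cases hn : n ∈ s.image φ
  · refine (iSupIndep_iff_finsetSum_eq_zero_imp_eq_zero _).1 hind (s.image φ)
      (fun n => ∑ i ∈ s with φ i = n, y i) (fun n _ => ?_) ?_ n hn
    · refine Submodule.sum_mem _ fun i hi => ?_
      rw [Finset.mem_filter] at hi
      rw [← hi.2]; exact hy i hi.1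
    · rw [← h]
      exact Finset.sum_fiberwise_of_maps_to (fun i hi => Finset.mem_image_of_mem φ hi) y
  · refine Finset.sum_eq_zero fun i hi => ?_
    rw [Finset.mem_filter] at hi
    exact absurd (hi.2 ▸ Finset.mem_image_of_mem φ hi.1) hn

lemma exists_weight_ne_bot {F : Finset ℂ} [Module ℂ[X] M] [Nontrivial M]
    (hF : Submodule.span ℂ[X] (⋃ c ∈ F, (D.maxGenEigenspace c : Set M)) = ⊤) :
    ∃ c, D.maxGenEigenspace c ≠ ⊥ := by
  by_contra! hcon
  refine bot_ne_top (α := Submodule ℂ[X] M) ?_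
  rw [← hF, eq_comm, Submodule.span_eq_bot]
  intro v hv
  obtain ⟨f, hf, hv⟩ := Set.mem_iUnion₂.1 hv
  rw [hcon f] at hv
  simpa using hv

end WeightSums

section Graded

variable {M : Type*} [AddCommGroup M] [Module ℂ M] [Module ℂ[X] M] [IsScalarTower ℂ ℂ[X] M]
  {D : Module.End ℂ M} {α : ℂ} {F : Finset ℂ}

lemma pow_smul_mem_weight
    (hD : ∀ v : M, D ((X + C α : ℂ[X]) • v) = (X + C α : ℂ[X]) • D v + (X + C α : ℂ[X]) • v)
    (k : ℕ) {c : ℂ} {v : M} (hv : v ∈ D.maxGenEigenspace c) :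
    ((X + C α : ℂ[X]) ^ k) • v ∈ D.maxGenEigenspace (c + k) := by
  induction k with
  | zero => simpa using hv
  | succ k ih =>
    have := map_mem_maxGenEigenspace (D := D) (f := Algebra.lsmul ℂ ℂ M (X + C α : ℂ[X])) (w := 1)
      (fun v => by rw [Algebra.lsmul_coe, hD, one_smul]) ih
    rw [Nat.cast_succ, ← add_assoc, pow_succ', mul_smul]
    exact this

lemma map_pow_mem_weight {a : Module.End ℂ[X] M} {w : ℂ} (ha : ∀ v, D (a v) = a (D v) + w • a v)
    (k : ℕ) {c : ℂ} {v : M} (hv : v ∈ D.maxGenEigenspace c) :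
    (a ^ k) v ∈ D.maxGenEigenspace (c + k * w) := by
  induction k with
  | zero => simpa using hv
  | succ k ih =>
    have := map_mem_maxGenEigenspace (D := D) (f := a.restrictScalars ℂ) (w := w) ha ih
    rw [pow_succ', Module.End.mul_apply]
    have hc : c + (k + 1 : ℕ) * w = c + k * w + w := by push_cast; ring
    rw [hc]
    exact this

lemma smul_eq_sum_pow_smul (f : ℂ[X]) {K : ℕ} (hK : f.natDegree < K) (v : M) :
    f • v = ∑ k ∈ Finset.range K, (taylor (-α) f).coeff k • (X + C α : ℂ[X]) ^ k • v := by
  have h1 : f = ∑ k ∈ Finset.range K, C ((taylor (-α) f).coeff k) * (X + C α : ℂ[X]) ^ k := by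
    conv_lhs => rw [← taylor_zero f, ← add_neg_cancel α, ← taylor_taylor, taylor_apply, Polynomial.comp,
      eval₂_eq_sum_range' C (n := K) (by rwa [natDegree_taylor])]
  conv_lhs => rw [h1]
  rw [Finset.sum_smul]
  exact Finset.sum_congr rfl fun k _ => by rw [mul_smul, C_smul]

/-- `M` is the sum of the spaces `(∂ + α)ᵏ M_f` with `f ∈ F`, which have weight `f + k`. A weight
space of any other weight meets this sum in zero by independence. -/
lemma exists_eq_add_nat_of_weight
    (hD : ∀ v : M, D ((X + C α : ℂ[X]) • v) = (X + C α : ℂ[X]) • D v + (X + C α : ℂ[X]) • v)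
    (hF : Submodule.span ℂ[X] (⋃ c ∈ F, (D.maxGenEigenspace c : Set M)) = ⊤)
    {c : ℂ} (hc : D.maxGenEigenspace c ≠ ⊥) : ∃ f ∈ F, ∃ n : ℕ, c = f + n := by
  by_contra! hcon
  apply hc
  let Z : Submodule ℂ M := ⨆ d ≠ c, D.maxGenEigenspace d
  have hgen : ∀ v : M, v ∈ Z := by
    intro v
    have hv : v ∈ Submodule.span ℂ[X] (⋃ c ∈ F, (D.maxGenEigenspace c : Set M)) := by
      rw [hF]; trivial
    induction hv using Submodule.closure_induction with
    | zero => exact Z.zero_mem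
    | add x y _ _ hx hy => exact Z.add_mem hx hy
    | smul_mem g x hx =>
      obtain ⟨f, hf, hx⟩ := Set.mem_iUnion₂.1 hx
      rw [smul_eq_sum_pow_smul (α := α) g (Nat.lt_succ_self _)]
      refine Z.sum_mem fun k _ => Z.smul_mem _ ?_
      have h1 := pow_smul_mem_weight hD k hx
      exact Submodule.mem_iSup_of_mem _ (Submodule.mem_iSup_of_mem (hcon f hf k).symm h1)
  have hdis := D.independent_maxGenEigenspace c
  rw [Submodule.eq_bot_iff]
  intro v hv
  exact Submodule.disjoint_def.1 hdis v hv (hgen v)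

/-- A finite nonzero graded module has a lowest weight. -/
lemma exists_lowest_weight [Nontrivial M]
    (hD : ∀ v : M, D ((X + C α : ℂ[X]) • v) = (X + C α : ℂ[X]) • D v + (X + C α : ℂ[X]) • v)
    (hF : Submodule.span ℂ[X] (⋃ c ∈ F, (D.maxGenEigenspace c : Set M)) = ⊤) :
    ∃ c, D.maxGenEigenspace c ≠ ⊥ ∧
      ∀ k : ℕ, 1 ≤ k → D.maxGenEigenspace (c - k) = ⊥ := by
  classical
  obtain ⟨c, hc⟩ := exists_weight_ne_bot hF
  -- If `c - k = f + n` then `k ≤ k + n = ‖c - f‖`; the sum over `F` bounds this uniformly in `f`.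
  have hbound : ∀ k : ℕ, D.maxGenEigenspace (c - k) ≠ ⊥ → k ≤ ⌊∑ f ∈ F, ‖c - f‖⌋₊ := by
    intro k hk
    obtain ⟨f, hf, n, hn⟩ := exists_eq_add_nat_of_weight hD hF hk
    have h1 : c - f = ((k + n : ℕ) : ℂ) := by push_cast; linear_combination hn
    refine Nat.le_floor ?_
    calc (k : ℝ) ≤ ((k + n : ℕ) : ℝ) := by push_cast; linarith [Nat.cast_nonneg (α := ℝ) n]
      _ = ‖c - f‖ := by rw [h1, Complex.norm_natCast]
      _ ≤ _ := Finset.single_le_sum (f := fun f => ‖c - f‖) (fun _ _ => norm_nonneg _) hf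
  set B := ⌊∑ f ∈ F, ‖c - f‖⌋₊
  have hspec := Nat.findGreatest_spec (P := fun k : ℕ => D.maxGenEigenspace (c - k) ≠ ⊥)
    (Nat.zero_le B) (by simpa using hc)
  refine ⟨_, hspec, fun k hk => ?_⟩
  by_contra h
  rw [sub_sub, ← Nat.cast_add] at h
  have := Nat.le_findGreatest
    (P := fun k : ℕ => D.maxGenEigenspace (c - k) ≠ ⊥) (hbound _ h) h
  omega

/-- The Cayley–Hamilton theorem for a homogeneous endomorphism. -/
lemma exists_homogeneous_charpoly [Module.Finite ℂ[X] M]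
    (hD : ∀ v : M, D ((X + C α : ℂ[X]) • v) = (X + C α : ℂ[X]) • D v + (X + C α : ℂ[X]) • v)
    (hF : Submodule.span ℂ[X] (⋃ c ∈ F, (D.maxGenEigenspace c : Set M)) = ⊤)
    {a : Module.End ℂ[X] M} {e : ℕ} (ha : ∀ v, D (a v) = a (D v) + (e : ℂ) • a v) :
    ∃ P : ℂ[X], P.Monic ∧ aeval a ((P.map C).scaleRoots ((X + C α : ℂ[X]) ^ e)) = 0 := by
  obtain ⟨χ, hχ, hχa⟩ := LinearMap.exists_monic_and_aeval_eq_zero ℂ[X] a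
  set N := χ.natDegree
  -- The homogeneous part of `χ`: since `a` has weight `e` and `∂ + α` has weight 1, the term `(∂ +
  -- α)^(e(N-s)) aˢ` has weight `eN`, and only such terms are kept.
  let P : ℂ[X] := ∑ s ∈ Finset.range (N + 1),
    monomial s ((taylor (-α) (χ.coeff s)).coeff (e * (N - s)))
  have hPc : ∀ s, s ≤ N → P.coeff s = (taylor (-α) (χ.coeff s)).coeff (e * (N - s)) := by
    intro s hs
    simp only [P, finsetSum_coeff, coeff_monomial, Finset.sum_ite_eq']
    rw [if_pos (Finset.mem_range.2 (by omega))]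
  have hPdeg : P.natDegree ≤ N := by
    refine natDegree_sum_le_of_forall_le _ _ fun s hs => ?_
    exact (natDegree_monomial_le _).trans (by have := Finset.mem_range.1 hs; omega)
  have hPN : P.coeff N = 1 := by
    rw [hPc N le_rfl, hχ.coeff_natDegree]; simp
  have hPm : P.Monic := monic_of_natDegree_le_of_coeff_eq_one N hPdeg hPN
  have hPnd : P.natDegree = N := natDegree_eq_of_le_of_coeff_ne_zero hPdeg (by simp [hPN])
  refine ⟨P, hPm, ?_⟩
  have hmapdeg : (P.map C).natDegree = N := by
    rw [natDegree_map_eq_of_injective C_injective, hPnd]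
  set Q := aeval a ((P.map C).scaleRoots ((X + C α : ℂ[X]) ^ e)) with hQ
  have hweight : ∀ c, ∀ v ∈ D.maxGenEigenspace c, Q v = 0 := by
    intro c v hv
    obtain ⟨K, hK1, hK2⟩ : ∃ K, (∀ s ∈ Finset.range (N + 1), (χ.coeff s).natDegree < K) ∧
        e * N < K := by
      refine ⟨(Finset.range (N + 1)).sup (fun s => (χ.coeff s).natDegree) + e * N + 1,
        fun s hs => ?_, by omega⟩
      have := Finset.le_sup (f := fun s => (χ.coeff s).natDegree) hs
      omega
    have h0 := LinearMap.congr_fun hχa v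
    rw [aeval_eq_sum_range, LinearMap.sum_apply, LinearMap.zero_apply] at h0
    have h1 : ∑ x ∈ Finset.range (N + 1) ×ˢ Finset.range K,
        (taylor (-α) (χ.coeff x.1)).coeff x.2 • (X + C α : ℂ[X]) ^ x.2 • (a ^ x.1) v = 0 := by
      rw [Finset.sum_product, ← h0]
      refine Finset.sum_congr rfl fun s hs => ?_
      rw [LinearMap.smul_apply, smul_eq_sum_pow_smul (α := α) _ (hK1 s hs)]
    -- The component of weight `c + eN` of the relation `χ(a)v = 0`.
    have h2 := sum_weight_eq_zero (D := D) (c := c) _ (fun x : ℕ × ℕ => x.2 + x.1 * e) _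
      (fun x _ => by
        refine Submodule.smul_mem _ _ ?_
        have := pow_smul_mem_weight hD x.2 (map_pow_mem_weight ha x.1 hv)
        convert this using 2
        push_cast; ring) h1 (e * N)
    rw [hQ, aeval_eq_sum_range, LinearMap.sum_apply, natDegree_scaleRoots, hmapdeg, ← h2,
      Finset.sum_filter, Finset.sum_product]
    refine Finset.sum_congr rfl fun s hs => ?_
    have hs' : s ≤ N := by have := Finset.mem_range.1 hs; omega
    have hmul : e * (N - s) + s * e = e * N := by
      obtain ⟨r, hr⟩ := Nat.exists_eq_add_of_le hs'
      rw [hr, Nat.add_sub_cancel_left]; ring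
    rw [Finset.sum_eq_single (e * (N - s))]
    · rw [if_pos hmul, coeff_scaleRoots, hmapdeg, coeff_map, hPc s hs', LinearMap.smul_apply,
        mul_smul, C_smul, pow_mul]
    · intro k _ hk
      rw [if_neg]
      intro h
      exact hk (by simp only at h; omega)
    · intro h
      refine absurd (Finset.mem_range.2 (lt_of_le_of_lt ?_ hK2)) h
      exact Nat.mul_le_mul_left _ (Nat.sub_le _ _)
  refine LinearMap.ext fun v => ?_
  have hv : v ∈ Submodule.span ℂ[X] (⋃ c ∈ F, (D.maxGenEigenspace c : Set M)) := by
    rw [hF]; trivial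
  have hle : Submodule.span ℂ[X] (⋃ c ∈ F, (D.maxGenEigenspace c : Set M)) ≤ LinearMap.ker Q := by
    rw [Submodule.span_le]
    intro w hw
    obtain ⟨f, hf, hw⟩ := Set.mem_iUnion₂.1 hw
    exact hweight f w hw
  exact hle hv

end Graded

/-! ### Eigenvectors of homogeneous endomorphisms -/

section Eigenvectors

variable {M : Type*} [AddCommGroup M] [Module ℂ[X] M]

/-- Over `ℂ` the scaled polynomial splits into factors `a - κs`. They are peeled off one at a time
until the remaining product no longer kills `u`. The vector is recorded as `q(a)u` because this form
survives commuting operators. -/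
lemma exists_eigenvector_of_aeval_scaleRoots (a : Module.End ℂ[X] M) (s : ℂ[X]) (N : ℕ) :
    ∀ (P : ℂ[X]), P.Monic → P.natDegree = N → ∀ u : M, u ≠ 0 →
      aeval a ((P.map C).scaleRoots s) u = 0 →
      ∃ (κ : ℂ) (q : ℂ[X][X]), aeval a q u ≠ 0 ∧
        a (aeval a q u) = (C κ * s) • aeval a q u ∧ ((∀ k, (a ^ k) u ≠ 0) → κ ≠ 0) := by
  induction N with
  | zero =>
    intro P hP hN u hu h
    rw [hP.natDegree_eq_zero.1 hN] at h
    simp [one_scaleRoots] at h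
    exact absurd h hu
  | succ N ih =>
    intro P hP hN u hu h
    obtain ⟨κ, hκ⟩ := Complex.exists_root (f := P) (by
      rw [← natDegree_pos_iff_degree_pos]; omega)
    obtain ⟨P', rfl⟩ := dvd_iff_isRoot.2 hκ
    have hP' : P'.Monic := (monic_X_sub_C κ).of_mul_monic_left hP
    have hN' : P'.natDegree = N := by
      rw [(monic_X_sub_C κ).natDegree_mul hP', natDegree_X_sub_C] at hN; omega
    set R := (P'.map C).scaleRoots s with hR
    have hfac : (((X - C κ) * P').map C).scaleRoots s = (X - C (C κ * s)) * R := by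
      rw [Polynomial.map_mul, mul_scaleRoots_of_noZeroDivisors, Polynomial.map_sub, map_X, map_C,
        X_sub_C_scaleRoots]
    rw [hfac, map_mul, Module.End.mul_apply] at h
    have h' : a (aeval a R u) = (C κ * s) • aeval a R u := by
      rwa [map_sub, aeval_X, aeval_C, LinearMap.sub_apply, Module.algebraMap_end_apply,
        sub_eq_zero] at h
    by_cases hu1 : aeval a R u = 0
    · exact ih P' hP' hN' u hu hu1
    · by_cases hκ0 : (∀ k, (a ^ k) u ≠ 0) → κ ≠ 0
      · exact ⟨κ, R, hu1, h', hκ0⟩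
      -- The root is 0 although no power of `a` kills `u`: `R(a)` then kills `a u`, which is again
      -- killed by no power of `a`, so the induction continues with `a u`.
      · push Not at hκ0
        obtain ⟨hnil, rfl⟩ := hκ0
        obtain ⟨κ', q, h1, h2, h3⟩ := ih P' hP' hN' (a u) (by simpa using hnil 1) (by
          have hcomm : aeval a R (a u) = aeval a (R * X) u := by
            rw [map_mul, Module.End.mul_apply, aeval_X]
          rw [← hR, hcomm, mul_comm, map_mul, Module.End.mul_apply, aeval_X, h', C_0, zero_mul,
            zero_smul])
        have hq : aeval a (q * X) u = aeval a q (a u) := by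
          rw [map_mul, Module.End.mul_apply, aeval_X]
        refine ⟨κ', q * X, by rwa [hq], by rwa [hq], fun _ => h3 fun k => ?_⟩
        have := hnil (k + 1)
        rwa [pow_succ, Module.End.mul_apply] at this

end Eigenvectors

section NotNilpotent

variable {M : Type*} [AddCommGroup M] [Module ℂ M] [Module ℂ[X] M] {D : Module.End ℂ M}
  {F : Finset ℂ}

lemma exists_weight_vector_not_nilpotent [Module.Finite ℂ[X] M]
    (hF : Submodule.span ℂ[X] (⋃ c ∈ F, (D.maxGenEigenspace c : Set M)) = ⊤)
    {a : Module.End ℂ[X] M} (hnil : ¬ IsNilpotent a) :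
    ∃ c, ∃ u ∈ D.maxGenEigenspace c, ∀ k, (a ^ k) u ≠ 0 := by
  by_contra! hcon
  apply hnil
  have htop : a.maxGenEigenspace 0 = ⊤ := by
    rw [eq_top_iff, ← hF, Submodule.span_le]
    intro v hv
    obtain ⟨c, -, hv⟩ := Set.mem_iUnion₂.1 hv
    obtain ⟨k, hk⟩ := hcon c v hv
    rw [SetLike.mem_coe, Module.End.mem_maxGenEigenspace]
    exact ⟨k, by simpa using hk⟩
  rw [Module.End.isNilpotent_iff_of_finite]
  intro v
  have hv : v ∈ a.maxGenEigenspace 0 := by rw [htop]; trivial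
  rw [Module.End.mem_maxGenEigenspace] at hv
  simpa using hv

end NotNilpotent

section Homogeneous

variable {M : Type*} [AddCommGroup M] [Module ℂ M] [Module ℂ[X] M] [IsScalarTower ℂ ℂ[X] M]
  {D : Module.End ℂ M} {α : ℂ} {F : Finset ℂ}

lemma weight_pow {a : Module.End ℂ[X] M} {w : ℂ} (ha : ∀ v, D (a v) = a (D v) + w • a v) (b : ℕ)
    (v : M) : D ((a ^ b) v) = (a ^ b) (D v) + (b * w) • (a ^ b) v := by
  induction b with
  | zero => simp
  | succ b ih =>
    rw [pow_succ', Module.End.mul_apply, ha, ih, map_add, LinearMap.map_smul_of_tower]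
    simp only [Module.End.mul_apply]
    push_cast
    module

/-- The weight of a homogeneous endomorphism that is not nilpotent is a nonnegative rational. -/
lemma exists_mul_weight_eq_natCast [Module.Finite ℂ[X] M]
    (hD : ∀ v : M, D ((X + C α : ℂ[X]) • v) = (X + C α : ℂ[X]) • D v + (X + C α : ℂ[X]) • v)
    (hF : Submodule.span ℂ[X] (⋃ c ∈ F, (D.maxGenEigenspace c : Set M)) = ⊤)
    {a : Module.End ℂ[X] M} {w : ℂ} (ha : ∀ v, D (a v) = a (D v) + w • a v) (hw : w ≠ 0)
    (hnil : ¬ IsNilpotent a) : ∃ b e : ℕ, 1 ≤ b ∧ 1 ≤ e ∧ (b : ℂ) * w = e := by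
  obtain ⟨c, u, huc, hu⟩ := exists_weight_vector_not_nilpotent hF hnil
  have hex : ∀ k : ℕ, ∃ f : F, ∃ n : ℕ, c + k * w = f + n := by
    intro k
    have hne : D.maxGenEigenspace (c + k * w) ≠ ⊥ := by
      intro h
      have := map_pow_mem_weight ha k huc
      rw [h, Submodule.mem_bot] at this
      exact hu k this
    obtain ⟨f, hf, n, hn⟩ := exists_eq_add_nat_of_weight hD hF hne
    exact ⟨⟨f, hf⟩, n, hn⟩
  choose f n hfn using hex
  obtain ⟨y, hy⟩ := Finite.exists_infinite_fiber f
  have hT : (f ⁻¹' {y}).Infinite := Set.infinite_coe_iff.1 hy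
  classical
  have hex2 : ∃ r, ∃ k ∈ f ⁻¹' {y}, n k = r := by
    obtain ⟨k, hk⟩ := hT.nonempty
    exact ⟨_, k, hk, rfl⟩
  -- The weights `c + kw` lie in `F + ℕ`, and infinitely many of them lie over one `f`. Taking `k0`
  -- with the least natural part and any larger `k1` gives `(k1 - k0)w ∈ ℕ`.
  obtain ⟨k0, hk0, hn0⟩ := Nat.find_spec hex2
  obtain ⟨k1, hk1, hlt⟩ := hT.exists_gt k0
  have hle : n k0 ≤ n k1 := by
    rw [hn0]; exact Nat.find_min' hex2 ⟨k1, hk1, rfl⟩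
  have h0 := hfn k0
  have h1 := hfn k1
  rw [show f k0 = y from hk0] at h0
  rw [show f k1 = y from hk1] at h1
  have heq : ((k1 - k0 : ℕ) : ℂ) * w = (n k1 - n k0 : ℕ) := by
    rw [Nat.cast_sub hlt.le, Nat.cast_sub hle]
    linear_combination h1 - h0
  refine ⟨k1 - k0, n k1 - n k0, by omega, ?_, heq⟩
  rw [Nat.one_le_iff_ne_zero]
  intro h
  rw [h, Nat.cast_zero, mul_eq_zero, or_iff_left hw, Nat.cast_eq_zero] at heq
  omega

lemma exists_eigenvector_ne_zero [Module.Finite ℂ[X] M]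
    (hD : ∀ v : M, D ((X + C α : ℂ[X]) • v) = (X + C α : ℂ[X]) • D v + (X + C α : ℂ[X]) • v)
    (hF : Submodule.span ℂ[X] (⋃ c ∈ F, (D.maxGenEigenspace c : Set M)) = ⊤)
    {a : Module.End ℂ[X] M} {e : ℕ} (ha : ∀ v, D (a v) = a (D v) + (e : ℂ) • a v)
    (hnil : ¬ IsNilpotent a) :
    ∃ κ : ℂ, κ ≠ 0 ∧ ∃ u : M, u ≠ 0 ∧ a u = (C κ * (X + C α : ℂ[X]) ^ e) • u := by
  obtain ⟨P, hP, hPa⟩ := exists_homogeneous_charpoly hD hF ha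
  obtain ⟨-, u, -, hu⟩ := exists_weight_vector_not_nilpotent hF hnil
  obtain ⟨κ, q, h1, h2, h3⟩ := exists_eigenvector_of_aeval_scaleRoots a ((X + C α : ℂ[X]) ^ e) _ P
    hP rfl u (by simpa using hu 0) (by rw [hPa]; rfl)
  exact ⟨κ, h3 hu, _, h1, h2⟩

/-- The eigenvector for `b` is found as `q(b)u` with `u` an eigenvector for `a`; it remains one for
`a` because `a` commutes with `q(b)`. -/
lemma exists_joint_eigenvector [Module.Finite ℂ[X] M]
    (hD : ∀ v : M, D ((X + C α : ℂ[X]) • v) = (X + C α : ℂ[X]) • D v + (X + C α : ℂ[X]) • v)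
    (hF : Submodule.span ℂ[X] (⋃ c ∈ F, (D.maxGenEigenspace c : Set M)) = ⊤)
    {a b : Module.End ℂ[X] M} {e e' : ℕ} (ha : ∀ v, D (a v) = a (D v) + (e : ℂ) • a v)
    (hb : ∀ v, D (b v) = b (D v) + (e' : ℂ) • b v) (hab : Commute a b)
    (hnil : ¬ IsNilpotent a) :
    ∃ κ η : ℂ, κ ≠ 0 ∧ ∃ u : M, u ≠ 0 ∧ a u = (C κ * (X + C α : ℂ[X]) ^ e) • u ∧
      b u = (C η * (X + C α : ℂ[X]) ^ e') • u := by
  obtain ⟨κ, hκ, u, hu, hau⟩ := exists_eigenvector_ne_zero hD hF ha hnil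
  obtain ⟨P, hP, hPb⟩ := exists_homogeneous_charpoly hD hF hb
  obtain ⟨η, q, h1, h2, -⟩ := exists_eigenvector_of_aeval_scaleRoots b ((X + C α : ℂ[X]) ^ e') _ P
    hP rfl u hu (by rw [hPb]; rfl)
  refine ⟨κ, η, hκ, _, h1, ?_, h2⟩
  have hcomm : Commute a (aeval b q) := by
    rw [aeval_eq_sum_range]
    exact Commute.sum_right _ _ _ fun n _ => (hab.pow_right n).smul_right _
  rw [← Module.End.mul_apply, hcomm.eq, Module.End.mul_apply, hau, map_smul]

end Homogeneous

/-! ### Endomorphisms acting on coefficients -/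

section PolynomialMaps

variable {M : Type*} [AddCommGroup M] [Module ℂ[X] M]

lemma map_smul_polynomialModule (a : Module.End ℂ[X] M) (q : ℂ[X][X])
    (x : PolynomialModule ℂ[X] M) :
    PolynomialModule.map ℂ[X] a (q • x) = q • PolynomialModule.map ℂ[X] a x := by
  rw [PolynomialModule.map_smul, Algebra.algebraMap_self, Polynomial.map_id]

lemma map_mul_polynomialModule (a b : Module.End ℂ[X] M) (x : PolynomialModule ℂ[X] M) :
    PolynomialModule.map ℂ[X] (a * b) x =
      PolynomialModule.map ℂ[X] a (PolynomialModule.map ℂ[X] b x) := by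
  ext n
  simp only [coeff_map_polynomialModule, Module.End.mul_apply]

lemma map_zero_polynomialModule (x : PolynomialModule ℂ[X] M) :
    PolynomialModule.map ℂ[X] (0 : Module.End ℂ[X] M) x = 0 := by
  ext n
  simp only [coeff_map_polynomialModule, LinearMap.zero_apply]
  rfl

lemma map_one_polynomialModule (x : PolynomialModule ℂ[X] M) :
    PolynomialModule.map ℂ[X] (1 : Module.End ℂ[X] M) x = x := by
  ext n
  simp only [coeff_map_polynomialModule, Module.End.one_apply]

/-- If `∂ + λ` acts on a polynomial through an endomorphism of the coefficients, the polynomial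
is zero. -/
lemma eq_zero_of_shift_smul_eq_map [Module.IsTorsionFree ℂ[X] M] {q : ℂ[X]}
    (hq : 0 < q.natDegree) {a : Module.End ℂ[X] M} {x : PolynomialModule ℂ[X] M}
    (h : shift q • x = PolynomialModule.map ℂ[X] a x) : x = 0 := by
  by_contra hx
  obtain ⟨d, hd, hd'⟩ := exists_top_coeff hx
  -- Multiplication by `q(∂ + λ)` raises the degree in `λ` by `deg q > 0`, while `a` cannot raise
  -- it.
  have := (coeff_smul_of_degree_le (natDegree_shift q).le hd').2
  rw [h, coeff_shift_natDegree, coeff_map_polynomialModule, hd' _ (by omega), map_zero] at this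
  refine smul_ne_zero ?_ hd this.symm
  rw [Ne, C_eq_zero, leadingCoeff_eq_zero]
  rintro rfl
  simp at hq

lemma C_mul_X_smul_eq_zero {c : ℂ} (hc : c ≠ 0)
    {x : PolynomialModule ℂ[X] M} (h : (C (C c) * X : ℂ[X][X]) • x = 0) : x = 0 := by
  refine X_smul_eq_zero ?_
  have := congrArg (fun y => (C (C c⁻¹) : ℂ[X][X]) • y) h
  simp only [smul_smul, smul_zero] at this
  rwa [← mul_assoc, ← C_mul, ← C_mul, inv_mul_cancel₀ hc, C_1, C_1, one_mul] at this

end PolynomialMaps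

/-! ### Vanishing of the higher fields -/

section BlockModule

variable {p : ℂ} {M : Type*} [AddCommGroup M] [Module ℂ M] [Module ℂ[X] M] [IsScalarTower ℂ ℂ[X] M]
  {ρ : ConformalModule (block p) M}

/-- With `a = Lⱼ(0)`, `(j + p)λ aˢ Lₖ₊ⱼ aᵗ = aˢ Lₖ aᵗ⁺¹ - aˢ⁺¹ Lₖ aᵗ`. If `aᴺ = 0`, the expression
`aˢ Lₖ aᵗ` vanishes once `s + t ≥ 2N`; each shift of the index by `j` lowers the required `s + t` by
1, down to 0. -/
lemma field_eventually_zero [Module.IsTorsionFree ℂ[X] M] {j : ℕ} (hj : (j : ℂ) + p ≠ 0)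
    (hnil : IsNilpotent (zeroMode ρ j)) : ∃ K, ∀ k, K ≤ k → ∀ v, field ρ k v = 0 := by
  set a : Module.End ℂ[X] M := zeroMode ρ j with ha
  obtain ⟨N, hN⟩ := hnil
  have key : ∀ r, r ≤ 2 * N → ∃ K, ∀ k, K ≤ k → ∀ s t, 2 * N ≤ s + t + r → ∀ v,
      PolynomialModule.map ℂ[X] (a ^ s) (field ρ k ((a ^ t) v)) = 0 := by
    intro r hr
    induction r with
    | zero =>
      refine ⟨0, fun k _ s t hst v => ?_⟩
      rcases le_or_gt N s with h | h
      · rw [pow_eq_zero_of_le h hN, map_zero_polynomialModule]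
      · rw [pow_eq_zero_of_le (by omega : N ≤ t) hN, LinearMap.zero_apply, map_zero, map_zero]
    | succ r ih =>
      obtain ⟨K, hK⟩ := ih (by omega)
      refine ⟨K + j, fun k hk s t hst v => C_mul_X_smul_eq_zero hj ?_⟩
      obtain ⟨i, rfl⟩ := Nat.exists_eq_add_of_le' hk
      have h1 := hK (i + K) (by omega) s (t + 1) (by omega) v
      have h2 := hK (i + K) (by omega) (s + 1) t (by omega) v
      rw [pow_succ', Module.End.mul_apply, ha, field_zeroMode, ← ha, map_add,
        map_smul_polynomialModule, ← map_mul_polynomialModule, ← pow_succ, h2, zero_add,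
        add_assoc] at h1
      exact h1
  obtain ⟨K, hK⟩ := key (2 * N) le_rfl
  refine ⟨K, fun k hk v => ?_⟩
  have := hK k hk 0 0 (by omega) v
  rwa [pow_zero, Module.End.one_apply, map_one_polynomialModule] at this

lemma weightOp_zeroMode (hp : p ≠ 0) (j : ℕ) (v : M) :
    weightOp ρ (zeroMode ρ j v) =
      zeroMode ρ j (weightOp ρ v) + (j / p + 1 : ℂ) • zeroMode ρ j v := by
  have := weightOp_mode ρ hp j 0 v
  rwa [Nat.cast_zero, sub_zero] at this

lemma field_pow_of_commute {n : ℕ} {a : Module.End ℂ[X] M}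
    (h : ∀ v, field ρ n (a v) = PolynomialModule.map ℂ[X] a (field ρ n v)) (b : ℕ) (v : M) :
    field ρ n ((a ^ b) v) = PolynomialModule.map ℂ[X] (a ^ b) (field ρ n v) := by
  induction b generalizing v with
  | zero => rw [pow_zero, Module.End.one_apply, map_one_polynomialModule]
  | succ b ih => rw [pow_succ', Module.End.mul_apply, h, ih, map_mul_polynomialModule]

/-- Leibniz rule for `[Lᵢ _λ, aˢ⁺¹]`: since `a` commutes with `Lₙ _λ`, the `s + 1` terms coincide.
-/
lemma field_pow_of_commutator {i j n : ℕ} (hij : i + j = n)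
    (hcomm : ∀ v, field ρ n (zeroMode ρ j v) =
      PolynomialModule.map ℂ[X] (zeroMode ρ j) (field ρ n v)) (s : ℕ) (v : M) :
    field ρ i (((zeroMode ρ j : Module.End ℂ[X] M) ^ (s + 1)) v) =
      PolynomialModule.map ℂ[X] ((zeroMode ρ j : Module.End ℂ[X] M) ^ (s + 1)) (field ρ i v) +
      (C (C ((s + 1 : ℂ) * (j + p))) * X : ℂ[X][X]) •
        PolynomialModule.map ℂ[X] ((zeroMode ρ j : Module.End ℂ[X] M) ^ s) (field ρ n v) := by
  set a : Module.End ℂ[X] M := zeroMode ρ j with ha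
  induction s generalizing v with
  | zero =>
    rw [zero_add, pow_one, pow_zero, map_one_polynomialModule, ha, field_zeroMode, hij]
    simp
  | succ s ih =>
    rw [pow_succ _ (s + 1), Module.End.mul_apply, ih, ha, field_zeroMode, hcomm, ← ha, hij, map_add,
      map_smul_polynomialModule, ← map_mul_polynomialModule, ← map_mul_polynomialModule, add_assoc,
      ← pow_succ, ← pow_succ, ← add_smul]
    congr 2
    rw [← add_mul, ← C_add, ← C_add]
    congr 3
    push_cast; ring

variable {α : ℂ} {F : Finset ℂ}

/-- The last field that is not zero: `Lₙ = 0` if `Lₖ = 0` for all `k > n`, provided that some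
`Lⱼ` with `1 ≤ j ≤ n` has `j + p ≠ 0`. -/
lemma field_eq_zero_of_top [Module.Finite ℂ[X] M] [Module.IsTorsionFree ℂ[X] M]
    (hp : p ≠ 0) (hirr : ρ.IsIrreducible)
    (hα : ∀ v, zeroMode ρ 0 v = p • (X + C α : ℂ[X]) • v)
    (hF : Submodule.span ℂ[X] (⋃ c ∈ F, ((weightOp ρ).maxGenEigenspace c : Set M)) = ⊤)
    {n j : ℕ} (hj1 : 1 ≤ j) (hjn : j ≤ n) (hj : (j : ℂ) + p ≠ 0)
    (htop : ∀ k, n < k → ∀ v, field ρ k v = 0) (v : M) : field ρ n v = 0 := by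
  have := hirr.1
  suffices h : ∃ u : M, u ≠ 0 ∧ field ρ n u = 0 by
    obtain ⟨u, hu, hnu⟩ := h
    refine field_eq_zero_of_irreducible hirr hu (fun k hk => ?_) le_rfl v
    rcases hk.eq_or_lt with rfl | hk
    · exact hnu
    · exact htop k hk u
  have hcomm : ∀ v, field ρ n (zeroMode ρ j v) =
      PolynomialModule.map ℂ[X] (zeroMode ρ j) (field ρ n v) := by
    intro v
    rw [field_zeroMode, htop (n + j) (by omega), smul_zero, add_zero]
  set a : Module.End ℂ[X] M := zeroMode ρ j with ha
  -- If `a` is nilpotent with `aˢ` its last nonzero power, commuting `Lₙ₋ⱼ` with `aˢ⁺¹ = 0` leaves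
  -- `(s + 1)(j + p)λ aˢ Lₙ = 0`, so `Lₙ` kills the image of `aˢ`.
  by_cases hnil : IsNilpotent a
  · classical
    have hex : ∃ N, a ^ N = 0 := hnil
    obtain ⟨s, hs⟩ : ∃ s, Nat.find hex = s + 1 := by
      refine Nat.exists_eq_succ_of_ne_zero fun h => ?_
      have := Nat.find_spec hex
      rw [h, pow_zero] at this
      exact one_ne_zero this
    have h1 : a ^ (s + 1) = 0 := by rw [← hs]; exact Nat.find_spec hex
    have h2 : a ^ s ≠ 0 := Nat.find_min hex (by omega)
    obtain ⟨u, hu⟩ : ∃ u, (a ^ s) u ≠ 0 := by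
      by_contra! h
      exact h2 (LinearMap.ext h)
    refine ⟨_, hu, ?_⟩
    have h3 := field_pow_of_commutator (i := n - j) (by omega) hcomm s u
    rw [← ha, h1, LinearMap.zero_apply, map_zero, map_zero_polynomialModule, zero_add] at h3
    rw [field_pow_of_commute hcomm]
    exact C_mul_X_smul_eq_zero (mul_ne_zero (by exact_mod_cast s.succ_ne_zero) hj) h3.symm
  -- Otherwise `aᵇ u = κ(∂ + α)ᵉ u` with `e ≥ 1`, and `Lₙ` commutes with `aᵇ`; comparing degrees in
  -- `λ` gives `Lₙ _λ u = 0`.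
  · have hD := weightOp_smul ρ hp hα
    have haw := weightOp_zeroMode (ρ := ρ) hp j
    have hw : (j / p + 1 : ℂ) ≠ 0 := by
      intro h; apply hj; field_simp at h; simpa using h
    obtain ⟨b, e, hb, he, hbe⟩ := exists_mul_weight_eq_natCast hD hF haw hw hnil
    obtain ⟨κ, hκ, u, hu, hau⟩ := exists_eigenvector_ne_zero hD hF (a := a ^ b) (e := e)
      (fun v => by rw [← hbe]; exact weight_pow haw b v)
      (fun h => hnil (IsNilpotent.of_pow h))
    refine ⟨u, hu, eq_zero_of_shift_smul_eq_map (q := C κ * (X + C α) ^ e) (a := a ^ b) ?_ ?_⟩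
    · rw [natDegree_C_mul hκ, natDegree_pow, natDegree_X_add_C]; omega
    · rw [← field_pow_of_commute hcomm, hau, field_smul]

end BlockModule

/-! ### Existence of a nilpotent zero mode -/

section BlockModule

variable {p : ℂ} {M : Type*} [AddCommGroup M] [Module ℂ M] [Module ℂ[X] M] [IsScalarTower ℂ ℂ[X] M]
  {ρ : ConformalModule (block p) M}

lemma commute_zeroMode (i j : ℕ) :
    Commute (zeroMode ρ i : Module.End ℂ[X] M) (zeroMode ρ j) := by
  refine LinearMap.ext fun v => ?_
  have h := congrArg (fun x => PolynomialModule.coeff x 0) (field_zeroMode ρ i j v)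
  simp only [PolynomialModule.coeff_add, Finsupp.add_apply, coeff_map_polynomialModule, mul_smul,
    coeff_C_smul, coeff_X_smul_zero, smul_zero, add_zero] at h
  exact h

lemma shift_C_mul_pow (κ α : ℂ) (e : ℕ) :
    shift (C κ * (X + C α) ^ e) = C (C κ) * (X + C (X + C α)) ^ e := by
  have hC : shift (C κ) = C (C κ) := by
    simp [shift, IsScalarTower.algebraMap_apply ℂ ℂ[X] ℂ[X][X]]
  rw [map_mul, map_pow, shift_X_add_C, add_comm (C _) X, hC]

/-- The polynomial relation on `w = L₀ _λ u` for a joint eigenvector `u` of `Lⱼ` and `L₂ⱼ`. -/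
lemma joint_eigenvector_relation {j : ℕ} {f g : ℂ[X]} {u : M}
    (hf : zeroMode ρ j u = f • u) (hg : zeroMode ρ (j + j) u = g • u) :
    (C (C ((j + j : ℕ) + p)) * shift f ^ 2 - C (C ((j : ℂ) + p)) ^ 2 * X * shift g : ℂ[X][X]) •
        field ρ 0 u =
      (C (C (2 * ((j + j : ℕ) + p))) * shift f : ℂ[X][X]) •
        PolynomialModule.map ℂ[X] (zeroMode ρ j) (field ρ 0 u) -
      (C (C ((j + j : ℕ) + p)) : ℂ[X][X]) •
        PolynomialModule.map ℂ[X] (zeroMode ρ j)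
          (PolynomialModule.map ℂ[X] (zeroMode ρ j) (field ρ 0 u)) -
      (C (C ((j : ℂ) + p)) ^ 2 * X : ℂ[X][X]) •
        PolynomialModule.map ℂ[X] (zeroMode ρ (j + j)) (field ρ 0 u) := by
  have e1 := field_zeroMode ρ 0 j u
  have e2 := field_zeroMode ρ j j u
  have e3 := field_zeroMode ρ 0 (j + j) u
  rw [hf, field_smul, zero_add] at e1
  rw [hf, field_smul] at e2
  rw [hg, field_smul, zero_add] at e3
  have e1' := congrArg (PolynomialModule.map ℂ[X] (zeroMode ρ j)) e1
  rw [map_add, map_smul_polynomialModule, map_smul_polynomialModule] at e1'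
  set W := field ρ 0 u
  set aW := PolynomialModule.map ℂ[X] (zeroMode ρ j) W
  set aaW := PolynomialModule.map ℂ[X] (zeroMode ρ j) aW
  set bW := PolynomialModule.map ℂ[X] (zeroMode ρ (j + j)) W
  set c₁ : ℂ[X][X] := C (C ((j : ℂ) + p))
  set c₂ : ℂ[X][X] := C (C (((j + j : ℕ) : ℂ) + p))
  have hc : (C (C (2 * ((j + j : ℕ) + p))) : ℂ[X][X]) = 2 * c₂ := by
    rw [C_mul, C_mul]; rfl
  rw [hc]
  -- The multipliers eliminate `Lⱼ _λ u` and `L₂ⱼ _λ u` from the three commutation relations.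
  have e2' := congrArg (fun x => (c₁ * X * c₂) • x) e2
  have e1s := congrArg (fun x => (c₂ * shift f) • x) e1
  have e1a := congrArg (fun x => c₂ • x) e1'
  have e3' := congrArg (fun x => (c₁ ^ 2 * X) • x) e3
  simp only [smul_add, smul_smul] at e2' e1s e1a e3'
  linear_combination (norm := module) e1s - e1a + e2' - e3'

variable {α : ℂ} {F : Finset ℂ}

/-- Here `Lⱼ(0)` and `L₂ⱼ(0)` have the integral weights `m + 1` and `2m + 1`. If `Lⱼ(0)` were not
nilpotent, a joint eigenvector `u` would satisfy `(δ + λ)²ᵐ⁺¹((A - B)λ + Aδ) W = (terms of degree ≤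
m + 1 + d)` with `W = L₀ _λ u` of degree `d` in `λ` and `δ = ∂ + α`. As `m ≥ 1`, the two top
coefficients give `A = B` and then `A = 0`, but `A ≠ 0`. -/
lemma isNilpotent_zeroMode_of_eq_mul [Module.Finite ℂ[X] M] [Module.IsTorsionFree ℂ[X] M]
    (hp : p ≠ 0) (hα : ∀ v, zeroMode ρ 0 v = p • (X + C α : ℂ[X]) • v)
    (hF : Submodule.span ℂ[X] (⋃ c ∈ F, ((weightOp ρ).maxGenEigenspace c : Set M)) = ⊤)
    {j m : ℕ} (hm : 1 ≤ m) (hj : (j : ℂ) = p * m) : IsNilpotent (zeroMode ρ j) := by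
  by_contra hnil
  have hD := weightOp_smul ρ hp hα
  obtain ⟨κ, η, hκ, u, hu, hau, hbu⟩ := exists_joint_eigenvector hD hF
    (a := zeroMode ρ j) (b := zeroMode ρ (j + j)) (e := m + 1) (e' := 2 * m + 1)
    (fun v => by
      rw [weightOp_zeroMode hp, hj, mul_div_cancel_left₀ _ hp]; push_cast; rfl)
    (fun v => by
      rw [weightOp_zeroMode hp, Nat.cast_add, hj, ← mul_add, mul_div_cancel_left₀ _ hp]
      push_cast; rw [two_mul])
    (commute_zeroMode j (j + j)) hnil
  have hrel := joint_eigenvector_relation hau hbu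
  have hδ : (X + C α : ℂ[X]) ≠ 0 := X_add_C_ne_zero α
  have hW : field ρ 0 u ≠ 0 := by
    intro h
    have h0 : zeroMode ρ 0 u = 0 := by
      rw [zeroMode_apply, mode_apply, h]; rfl
    rw [hα, ← C_smul] at h0
    exact smul_ne_zero (C_ne_zero.2 hp) (smul_ne_zero hδ hu) h0
  obtain ⟨d, hd, hd'⟩ := exists_top_coeff hW
  set W := field ρ 0 u
  have hmap : ∀ (a : Module.End ℂ[X] M) (x : PolynomialModule ℂ[X] M),
      (∀ n, d < n → x.coeff n = 0) →
      ∀ n, d < n → (PolynomialModule.map ℂ[X] a x).coeff n = 0 := by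
    intro a x hx n hn
    rw [coeff_map_polynomialModule, hx n hn, map_zero]
  set A := ((j + j : ℕ) + p) * κ ^ 2 with hA
  set B := ((j : ℂ) + p) ^ 2 * η with hB
  have hA0 : A ≠ 0 := by
    refine mul_ne_zero ?_ (pow_ne_zero 2 hκ)
    rw [Nat.cast_add, hj, show p * m + p * m + p = p * ((2 * m + 1 : ℕ) : ℂ) by push_cast; ring]
    exact mul_ne_zero hp (by exact_mod_cast (2 * m).succ_ne_zero)
  have hdegs : ∀ e, ((X + C (X + C α) : ℂ[X][X]) ^ e).natDegree = e := by
    intro e; rw [natDegree_pow, natDegree_X_add_C, mul_one]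
  have hvanish : ∀ n, m + 1 + d < n → ((C (C (2 * ((j + j : ℕ) + p))) *
        shift (C κ * (X + C α) ^ (m + 1)) : ℂ[X][X]) • PolynomialModule.map ℂ[X] (zeroMode ρ j) W -
      (C (C ((j + j : ℕ) + p)) : ℂ[X][X]) • PolynomialModule.map ℂ[X] (zeroMode ρ j)
          (PolynomialModule.map ℂ[X] (zeroMode ρ j) W) -
      (C (C ((j : ℂ) + p)) ^ 2 * X : ℂ[X][X]) •
        PolynomialModule.map ℂ[X] (zeroMode ρ (j + j)) W).coeff n = 0 := by
    intro n hn
    have hsub : ∀ x y : PolynomialModule ℂ[X] M, (x - y).coeff n = x.coeff n - y.coeff n := by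
      intro x y
      rw [eq_sub_iff_add_eq, ← Finsupp.add_apply, ← PolynomialModule.coeff_add, sub_add_cancel]
    rw [hsub, hsub,
      (coeff_smul_of_degree_le (e := m + 1) ?_ (hmap _ _ hd')).1 n hn,
      (coeff_smul_of_degree_le (e := m + 1) ?_ (hmap _ _ (hmap _ _ hd'))).1 n hn,
      (coeff_smul_of_degree_le (e := m + 1) ?_ (hmap _ _ hd')).1 n hn, sub_zero, sub_zero]
    · rw [← C_pow]
      exact ((natDegree_C_mul_le _ _).trans natDegree_X_le).trans (by omega)
    · rw [natDegree_C]; omega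
    · refine (natDegree_C_mul_le _ _).trans ?_
      rw [shift_C_mul_pow]
      exact (natDegree_C_mul_le _ _).trans (hdegs _).le
  rw [← hrel] at hvanish
  have hq : (C (C ((j + j : ℕ) + p)) * shift (C κ * (X + C α) ^ (m + 1)) ^ 2 -
      C (C ((j : ℂ) + p)) ^ 2 * X * shift (C η * (X + C α) ^ (2 * m + 1)) : ℂ[X][X]) =
      (X + C (X + C α)) ^ (2 * m + 1) * (C (C (A - B)) * X + C (C A * (X + C α))) := by
    rw [shift_C_mul_pow, shift_C_mul_pow, hA, hB]
    simp only [map_sub, map_mul, map_pow]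
    ring
  rw [hq] at hvanish
  have hmonic : ((X + C (X + C α) : ℂ[X][X]) ^ (2 * m + 1)).coeff (2 * m + 1) = 1 := by
    have := ((monic_X_add_C (X + C α : ℂ[X])).pow (2 * m + 1)).coeff_natDegree
    rwa [hdegs] at this
  have hAB : A - B = 0 := by
    by_contra hne
    have hdeg : ((X + C (X + C α)) ^ (2 * m + 1) *
        (C (C (A - B)) * X + C (C A * (X + C α))) : ℂ[X][X]).natDegree ≤ 2 * m + 1 + 1 :=
      natDegree_mul_le_of_le (hdegs _).le natDegree_linear_le
    have h1 := (coeff_smul_of_degree_le hdeg hd').2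
    rw [hvanish _ (by omega), coeff_mul_add_eq_of_natDegree_le (hdegs _).le natDegree_linear_le, hmonic,
      one_mul] at h1
    simp only [coeff_add, coeff_C_mul, coeff_X_one, mul_one, coeff_C_succ, add_zero] at h1
    exact smul_ne_zero (C_ne_zero.2 hne) hd h1.symm
  rw [hAB, C_0, C_0, zero_mul, zero_add] at hvanish
  have hdeg : ((X + C (X + C α)) ^ (2 * m + 1) *
      C (C A * (X + C α)) : ℂ[X][X]).natDegree ≤ 2 * m + 1 + 0 :=
    natDegree_mul_le_of_le (hdegs _).le (natDegree_C _).le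
  have h1 := (coeff_smul_of_degree_le hdeg hd').2
  rw [hvanish _ (by omega), coeff_mul_add_eq_of_natDegree_le (hdegs _).le (natDegree_C _).le, hmonic,
    one_mul] at h1
  rw [coeff_C_zero] at h1
  exact smul_ne_zero (mul_ne_zero (C_ne_zero.2 hA0) hδ) hd h1.symm

/-- Otherwise every weight `j/p + 1 ≠ 0` is a positive rational, so `p` is rational. If `p < 0`,
large `j` has negative weight; if `p > 0`, some `j ≥ 1` is an integral multiple of `p`, and
`isNilpotent_zeroMode_of_eq_mul` applies. -/
lemma exists_isNilpotent_zeroMode [Module.Finite ℂ[X] M] [Module.IsTorsionFree ℂ[X] M]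
    (hp : p ≠ 0) (hα : ∀ v, zeroMode ρ 0 v = p • (X + C α : ℂ[X]) • v)
    (hF : Submodule.span ℂ[X] (⋃ c ∈ F, ((weightOp ρ).maxGenEigenspace c : Set M)) = ⊤) :
    ∃ j : ℕ, (j : ℂ) + p ≠ 0 ∧ IsNilpotent (zeroMode ρ j) := by
  by_contra! hcon
  have hD := weightOp_smul ρ hp hα
  have hrat : ∀ j : ℕ, (j : ℂ) + p ≠ 0 →
      ∃ b e : ℕ, 1 ≤ b ∧ 1 ≤ e ∧ (b : ℂ) * (j / p + 1) = e := by
    intro j hj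
    refine exists_mul_weight_eq_natCast hD hF (weightOp_zeroMode (ρ := ρ) hp j) ?_ (hcon j hj)
    intro h; apply hj; field_simp at h; simpa using h
  obtain ⟨j₀, hj₀, hj₀p⟩ : ∃ j : ℕ, 1 ≤ j ∧ (j : ℂ) + p ≠ 0 := by
    by_cases h : (1 : ℕ) + p = 0
    · refine ⟨2, by norm_num, fun h2 => ?_⟩
      have : (1 : ℂ) = 0 := by push_cast at h h2; linear_combination h2 - h
      exact one_ne_zero this
    · exact ⟨1, le_rfl, h⟩
  obtain ⟨b, e, hb, he, hbe⟩ := hrat j₀ hj₀p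
  have hbj : (b : ℂ) * j₀ = p * (e - b) := by
    field_simp at hbe
    linear_combination hbe
  have hjpos : (b : ℂ) * j₀ ≠ 0 := by
    have : b * j₀ ≠ 0 := Nat.mul_ne_zero (by omega) (by omega)
    exact_mod_cast this
  rcases lt_trichotomy e b with h | h | h
  · obtain ⟨r, rfl⟩ := Nat.exists_eq_add_of_lt h
    -- The factor 2 makes the weight `-(2r + 1)`, which is negative; without it the weight is `-r`,
    -- which may be 0.
    have hj : ((2 * ((e + r + 1) * j₀) : ℕ) : ℂ) = p * -(2 * (r + 1)) := by
      push_cast at hbj ⊢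
      linear_combination 2 * hbj
    have hneg : ((2 * ((e + r + 1) * j₀) : ℕ) : ℂ) + p = -(p * (2 * r + 1 : ℕ)) := by
      rw [hj]; push_cast; ring
    obtain ⟨b', e', hb', he', hbe'⟩ := hrat (2 * ((e + r + 1) * j₀)) (by
      rw [hneg]
      exact neg_ne_zero.2 (mul_ne_zero hp (by exact_mod_cast (2 * r).succ_ne_zero)))
    rw [hj, mul_div_cancel_left₀ _ hp] at hbe'
    have : ((b' * (2 * r + 1) + e' : ℕ) : ℂ) = 0 := by
      push_cast
      linear_combination -hbe'
    have : b' * (2 * r + 1) + e' = 0 := by exact_mod_cast this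
    omega
  · rw [h, sub_self, mul_zero] at hbj
    exact hjpos hbj
  · obtain ⟨r, rfl⟩ := Nat.exists_eq_add_of_lt h
    have hj : ((b * j₀ : ℕ) : ℂ) = p * (r + 1 : ℕ) := by
      push_cast at hbj ⊢
      linear_combination hbj
    refine hcon (b * j₀) ?_ (isNilpotent_zeroMode_of_eq_mul hp hα hF (by omega) hj)
    rw [hj, show p * ((r + 1 : ℕ) : ℂ) + p = p * (r + 2 : ℕ) by push_cast; ring]
    exact mul_ne_zero hp (by exact_mod_cast (r + 1).succ_ne_zero)

/-- The fields `Lₖ` with `k ≥ n` are zero if for each of them some `1 ≤ j ≤ k` has `j + p ≠ 0`. -/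
lemma field_eq_zero_of_le [Module.Finite ℂ[X] M] [Module.IsTorsionFree ℂ[X] M]
    (hp : p ≠ 0) (hirr : ρ.IsIrreducible)
    (hα : ∀ v, zeroMode ρ 0 v = p • (X + C α : ℂ[X]) • v)
    (hF : Submodule.span ℂ[X] (⋃ c ∈ F, ((weightOp ρ).maxGenEigenspace c : Set M)) = ⊤)
    {n : ℕ} (hn : ∀ k, n ≤ k → ∃ j, 1 ≤ j ∧ j ≤ k ∧ (j : ℂ) + p ≠ 0) {k : ℕ} (hk : n ≤ k) (v : M) :
    field ρ k v = 0 := by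
  obtain ⟨j, hj, hnil⟩ := exists_isNilpotent_zeroMode hp hα hF
  obtain ⟨K, hK⟩ := field_eventually_zero hj hnil
  -- Downward induction from `K`, with `r` bounding the distance below `K`.
  have key : ∀ r k, n ≤ k → K ≤ k + r → ∀ v, field ρ k v = 0 := by
    intro r
    induction r with
    | zero => exact fun k _ hk => hK k hk
    | succ r ih =>
      intro k hnk hk
      obtain ⟨i, hi1, hik, hip⟩ := hn k hnk
      exact field_eq_zero_of_top hp hirr hα hF hi1 hik hip
        fun k' hk' => ih k' (by omega) (by omega)
  exact key K k hk (by omega) v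

end BlockModule

lemma exists_eigenvector_of_weight {M : Type*} [AddCommGroup M] [Module ℂ M] {D : Module.End ℂ M} {c : ℂ}
    (hc : D.maxGenEigenspace c ≠ ⊥) : ∃ u : M, u ≠ 0 ∧ D u = c • u := by
  classical
  obtain ⟨v, hv, hv0⟩ := Submodule.exists_mem_ne_zero_of_ne_bot hc
  rw [Module.End.mem_maxGenEigenspace] at hv
  obtain ⟨s, hs⟩ : ∃ s, Nat.find hv = s + 1 := by
    refine Nat.exists_eq_succ_of_ne_zero fun h => hv0 ?_
    have := Nat.find_spec hv
    rwa [h, pow_zero, Module.End.one_apply] at this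
  refine ⟨((D - c • 1) ^ s) v, Nat.find_min hv (by omega), ?_⟩
  have := Nat.find_spec hv
  rwa [hs, pow_succ', Module.End.mul_apply, LinearMap.sub_apply, LinearMap.smul_apply,
    Module.End.one_apply, sub_eq_zero] at this

/-! ### Lowest weight vectors and modules of rank one -/

section BlockModule

variable {p : ℂ} {M : Type*} [AddCommGroup M] [Module ℂ M] [Module ℂ[X] M] [IsScalarTower ℂ ℂ[X] M]
  {ρ : ConformalModule (block p) M}

/-- A mode whose weight is a negative integer sends the lowest weight space into a zero weight
space. Inside that space `u` is taken to be a genuine eigenvector. -/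
lemma exists_lowest_weight_vector [Module.Finite ℂ[X] M] [Module.IsTorsionFree ℂ[X] M]
    [Nontrivial M] (hp : p ≠ 0) {α : ℂ} {F : Finset ℂ}
    (hα : ∀ v, zeroMode ρ 0 v = p • (X + C α : ℂ[X]) • v)
    (hF : Submodule.span ℂ[X] (⋃ c ∈ F, ((weightOp ρ).maxGenEigenspace c : Set M)) = ⊤) :
    ∃ (Δ : ℂ) (u : M), u ≠ 0 ∧ mode ρ 0 1 u = (p * Δ) • u ∧
      ∀ j n k : ℕ, 1 ≤ k → (j / p + 1 - n : ℂ) = -k → mode ρ j n u = 0 := by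
  obtain ⟨c, hc, hlow⟩ := exists_lowest_weight (weightOp_smul ρ hp hα) hF
  obtain ⟨u, hu, hDu⟩ := exists_eigenvector_of_weight hc
  refine ⟨c, u, hu, ?_, fun j n k hk hjn => ?_⟩
  · rw [weightOp, LinearMap.smul_apply] at hDu
    rw [mul_smul, ← hDu, smul_smul, mul_inv_cancel₀ hp, one_smul]
  · have hmem : u ∈ (weightOp ρ).maxGenEigenspace c := by
      rw [Module.End.mem_maxGenEigenspace]
      exact ⟨1, by simp [hDu]⟩
    have := map_mem_maxGenEigenspace (weightOp_mode ρ hp j n) hmem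
    rwa [hjn, ← sub_eq_add_neg, hlow k hk, Submodule.mem_bot] at this

lemma eval_field_of_mode {i : ℕ} {u : M} (h : ∀ n, 2 ≤ n → mode ρ i n u = 0) (l : ℂ) :
    PolynomialModule.eval (C l) (field ρ i u) = mode ρ i 0 u + l • mode ρ i 1 u := by
  rw [eval_C_apply, Finsupp.sum_of_support_subset (s := {0, 1}) _ _ _ (by simp)]
  · rw [Finset.sum_pair zero_ne_one, pow_zero, one_smul, pow_one]; rfl
  · intro n hn
    by_contra hn'
    simp only [Finset.mem_insert, Finset.mem_singleton, not_or] at hn'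
    exact Finsupp.mem_support_iff.1 hn (h n (by omega))

lemma isSubmodule_span_singleton {u : M}
    (h : ∀ i n, mode ρ i n u ∈ Submodule.span ℂ[X] {u}) :
    ρ.IsSubmodule (Submodule.span ℂ[X] {u}) := by
  refine isSubmodule_of_mode_mem ρ _ fun i n v hv => ?_
  obtain ⟨g, rfl⟩ := Submodule.mem_span_singleton.1 hv
  rw [mode_apply, field_smul, PolynomialModule.smul_apply]
  exact Submodule.sum_mem _ fun x _ => Submodule.smul_mem _ _ (h i _)

/-- In an irreducible module generated by `u`, some `Lᵢ _λ u` is not divisible by `∂ + α`. -/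
lemma exists_mode_notMem_span [Module.IsTorsionFree ℂ[X] M] (hirr : ρ.IsIrreducible) {u : M}
    (hu : u ≠ 0) (α : ℂ) :
    ∃ i n, mode ρ i n u ∉ Submodule.span ℂ[X] {(X + C α : ℂ[X]) • u} := by
  by_contra! h
  -- Since `Lᵢ _λ (δu) = (δ + λ) Lᵢ _λ u` for `δ = ∂ + α`, the span of `δu` would be a submodule; it
  -- is nonzero, and proper because `δ` is not a unit.
  have hsub : ρ.IsSubmodule (Submodule.span ℂ[X] {(X + C α : ℂ[X]) • u}) := by
    refine isSubmodule_span_singleton fun i n => ?_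
    rcases n with _ | n
    · rw [← zeroMode_apply, map_smul]
      exact Submodule.smul_mem _ _ (h i 0)
    · rw [mode_X_add_C_smul_succ]
      exact Submodule.add_mem _ (Submodule.smul_mem _ _ (h i _)) (h i _)
  rcases hirr.2 _ hsub with hb | ht
  · rw [Submodule.span_singleton_eq_bot] at hb
    exact smul_ne_zero (X_add_C_ne_zero α) hu hb
  · obtain ⟨g, hg⟩ := Submodule.mem_span_singleton.1
      (ht ▸ Submodule.mem_top : u ∈ Submodule.span ℂ[X] {(X + C α : ℂ[X]) • u})
    rw [smul_smul, ← sub_eq_zero, ← one_smul ℂ[X] u, smul_smul, mul_one, ← sub_smul] at hg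
    have h1 := (smul_eq_zero.1 hg).resolve_right hu
    exact not_isUnit_X_add_C α (IsUnit.of_mul_eq_one g (by linear_combination h1))

/-- A conformal module that is free on a vector `u` with `Lᵢ _λ u = Pᵢ(∂, λ) u`. -/
lemma isomorphic_rankOneModule [Module.IsTorsionFree ℂ[X] M] {P : ℕ → ℂ[X][X]} (hP) {u : M}
    (hu : u ≠ 0) (hspan : Submodule.span ℂ[X] {u} = ⊤)
    (h : ∀ (i : ℕ) (l : ℂ), PolynomialModule.eval (C l) (field ρ i u) = (P i).eval (C l) • u) :
    ρ.IsFreeOfRankOne ∧ ρ.Isomorphic (rankOneModule p P hP) := by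
  let ψ : ℂ[X] ≃ₗ[ℂ[X]] M := LinearEquiv.ofBijective (LinearMap.toSpanSingleton ℂ[X] M u)
    ⟨by
      rw [← LinearMap.ker_eq_bot, LinearMap.ker_eq_bot']
      intro g hg
      exact (smul_eq_zero.1 hg).resolve_right hu,
    by rw [← LinearMap.range_eq_top, LinearMap.range_toSpanSingleton, hspan]⟩
  have hψ : ∀ g, ψ g = g • u := fun _ => rfl
  refine ⟨⟨Module.Free.of_equiv ψ, ?_⟩, ψ.symm, fun a v k => ?_⟩
  · rw [← Cardinal.lift_inj, ← ψ.lift_rank_eq, Module.rank_self, Cardinal.lift_one, Cardinal.lift_one]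
  · obtain ⟨g, rfl⟩ := ψ.surjective v
    rw [LinearEquiv.symm_apply_apply, LinearEquiv.eq_symm_apply, hψ g]
    have key : ∀ l, lamEval l (ρ.act a (g • u)) =
        ψ (lamEval l ((rankOneModule p P hP).act a g)) := by
      intro l
      induction a using Finsupp.induction_linear with
      | zero => simp
      | add a b ha hb => simp only [map_add, LinearMap.add_apply, ha, hb]
      | single i f =>
        rw [lamEval_act_single, ← eval_field, h]
        simp only [rankOneModule, lamEval, lamSubst_rankOneAct, hψ, smul_smul]
        congr 1; ring
    have hc := coeff_eq_zero_of_lamEval (x := ρ.act a (g • u) - PolynomialModule.map ℂ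
      (ψ.toLinearMap.restrictScalars ℂ) ((rankOneModule p P hP).act a g)) (fun l => by
        have hmap : lamEval l (PolynomialModule.map ℂ (ψ.toLinearMap.restrictScalars ℂ)
            ((rankOneModule p P hP).act a g)) =
            ψ (lamEval l ((rankOneModule p P hP).act a g)) := by
          rw [lamEval_apply, lamEval_apply, PolynomialModule.map]
          simp only [LinearMap.comp_apply, LinearEquiv.coe_coe,
            PolynomialModule.coeffLinearEquiv_apply, PolynomialModule.coeffLinearEquiv_symm_apply,
            PolynomialModule.coeff_ofCoeff, Finsupp.mapRange.linearMap_apply]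
          rw [Finsupp.sum_mapRange_index (by simp), map_finsuppSum]
          refine Finsupp.sum_congr fun n _ => ?_
          exact ((ψ.toLinearMap.restrictScalars ℂ).map_smul _ _).symm
        rw [map_sub, key, hmap, sub_self]) k
    have hsub : ∀ x y : PolynomialModule ℂ M, (x - y).coeff k = x.coeff k - y.coeff k := by
      intro x y
      rw [eq_sub_iff_add_eq, ← Finsupp.add_apply, ← PolynomialModule.coeff_add, sub_add_cancel]
    rw [hsub, coeff_map_polynomialModule, sub_eq_zero] at hc
    exact hc.symm

end BlockModule

/-! ### The two cases of the classification -/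

section Classification

lemma classification_of_ne_neg_one {p : ℂ} (hp : p ≠ 0) (hp1 : p ≠ -1)
    {M : Type*} [AddCommGroup M] [Module ℂ M] [Module ℂ[X] M] [IsScalarTower ℂ ℂ[X] M]
    (ρ : ConformalModule (block p) M) (hnt : ρ.IsNontrivial) (hfin : ρ.IsFinite)
    (hirr : ρ.IsIrreducible) :
    ρ.IsFreeOfRankOne ∧ ∃ Δ α : ℂ, Δ ≠ 0 ∧ ρ.Isomorphic (modM p Δ α) := by
  have := hirr.1
  have : Module.Finite ℂ[X] M := hfin
  have := isTorsionFree hirr hnt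
  obtain ⟨α, hα⟩ := exists_zeroMode_zero hp hirr
  obtain ⟨F, hF⟩ := exists_finset_span_weight ρ hp hα
  have hzero : ∀ k, 1 ≤ k → ∀ v, field ρ k v = 0 := fun k hk v =>
    field_eq_zero_of_le hp hirr hα hF (n := 1)
      (fun k hk => ⟨1, le_rfl, hk, fun h => hp1 (by push_cast at h; linear_combination h)⟩) hk v
  obtain ⟨Δ, u, hu, hu1, hlow⟩ := exists_lowest_weight_vector hp hα hF
  have h00 : mode ρ 0 0 u = (C p * (X + C α) : ℂ[X]) • u := by
    rw [← zeroMode_apply, hα, mul_smul, C_smul]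
  have h02 : ∀ n, 2 ≤ n → mode ρ 0 n u = 0 := by
    intro n hn
    refine hlow 0 n (n - 1) (by omega) ?_
    rw [Nat.cast_sub (by omega)]; simp
  have hk : ∀ k, 1 ≤ k → ∀ n, mode ρ k n u = 0 := fun k hk =>
    field_eq_zero_iff ρ |>.1 (hzero k hk u)
  have hspan : Submodule.span ℂ[X] {u} = ⊤ := by
    refine (hirr.2 _ (isSubmodule_span_singleton fun i n => ?_)).resolve_left fun h =>
      hu (Submodule.span_singleton_eq_bot.1 h)
    rcases i with _ | i
    · rcases n with _ | _ | n
      · rw [h00]; exact Submodule.smul_mem _ _ (Submodule.mem_span_singleton_self u)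
      · rw [hu1, ← C_smul]; exact Submodule.smul_mem _ _ (Submodule.mem_span_singleton_self u)
      · rw [h02 _ (by omega)]; exact Submodule.zero_mem _
    · rw [hk _ (by omega)]; exact Submodule.zero_mem _
  have hΔ : Δ ≠ 0 := by
    rintro rfl
    obtain ⟨i, n, hin⟩ := exists_mode_notMem_span hirr hu α
    apply hin
    rcases i with _ | i
    · rcases n with _ | _ | n
      · rw [h00, mul_smul]
        exact Submodule.smul_mem _ _ (Submodule.mem_span_singleton_self _)
      · rw [hu1, mul_zero, zero_smul]; exact Submodule.zero_mem _
      · rw [h02 _ (by omega)]; exact Submodule.zero_mem _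
    · rw [hk _ (by omega)]; exact Submodule.zero_mem _
  have hiso : ρ.IsFreeOfRankOne ∧ ρ.Isomorphic (modM p Δ α) :=
    isomorphic_rankOneModule _ hu hspan (fun i l => by
      rcases i with _ | i
      · rw [eval_field_of_mode h02, h00, hu1, ← C_smul, ← C_smul, smul_smul, ← add_smul]
        congr 1
        simp; ring
      · rw [hzero _ (by omega)]; simp)
  exact ⟨hiso.1, Δ, α, hΔ, hiso.2⟩

/-- For `p = -1` the index `j = 1` has `j + p = 0`. So `L₁(0)` commutes with all fields and is a
scalar `β`, and the vanishing argument, run with `j = 2`, starts only at `L₂`. -/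
lemma classification_of_eq_neg_one
    {M : Type*} [AddCommGroup M] [Module ℂ M] [Module ℂ[X] M] [IsScalarTower ℂ ℂ[X] M]
    (ρ : ConformalModule (block (-1)) M) (hnt : ρ.IsNontrivial) (hfin : ρ.IsFinite)
    (hirr : ρ.IsIrreducible) :
    ρ.IsFreeOfRankOne ∧ ∃ Δ α β : ℂ, (Δ ≠ 0 ∨ β ≠ 0) ∧ ρ.Isomorphic (modN Δ α β) := by
  have := hirr.1
  have : Module.Finite ℂ[X] M := hfin
  have := isTorsionFree hirr hnt
  have hp : (-1 : ℂ) ≠ 0 := neg_ne_zero.2 one_ne_zero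
  obtain ⟨α, hα⟩ := exists_zeroMode_zero hp hirr
  obtain ⟨β, hβ⟩ := exists_eq_smul_of_commute hirr (zeroMode ρ 1) fun i v => by
    rw [field_zeroMode]; simp
  obtain ⟨F, hF⟩ := exists_finset_span_weight ρ hp hα
  have hzero : ∀ k, 2 ≤ k → ∀ v, field ρ k v = 0 := fun k hk v =>
    field_eq_zero_of_le hp hirr hα hF (n := 2)
      (fun k hk => ⟨2, by norm_num, hk, by norm_num⟩) hk v
  obtain ⟨Δ, u, hu, hu1, hlow⟩ := exists_lowest_weight_vector hp hα hF
  have h00 : mode ρ 0 0 u = (-(X + C α) : ℂ[X]) • u := by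
    rw [← zeroMode_apply, hα, neg_smul, neg_smul, one_smul]
  have h02 : ∀ n, 2 ≤ n → mode ρ 0 n u = 0 := by
    intro n hn
    refine hlow 0 n (n - 1) (by omega) ?_
    rw [Nat.cast_sub (by omega)]; simp
  have h10 : mode ρ 1 0 u = (C β : ℂ[X]) • u := by
    rw [← zeroMode_apply, hβ, C_smul]
  -- For `p = -1` the mode `L₁(n)` has weight `-n`.
  have h11 : ∀ n, 1 ≤ n → mode ρ 1 n u = 0 := by
    intro n hn
    refine hlow 1 n n hn ?_
    norm_num
  have hk : ∀ k, 2 ≤ k → ∀ n, mode ρ k n u = 0 := fun k hk =>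
    field_eq_zero_iff ρ |>.1 (hzero k hk u)
  have hspan : Submodule.span ℂ[X] {u} = ⊤ := by
    refine (hirr.2 _ (isSubmodule_span_singleton fun i n => ?_)).resolve_left fun h =>
      hu (Submodule.span_singleton_eq_bot.1 h)
    rcases i with _ | _ | i
    · rcases n with _ | _ | n
      · rw [h00]; exact Submodule.smul_mem _ _ (Submodule.mem_span_singleton_self u)
      · rw [hu1, ← C_smul]; exact Submodule.smul_mem _ _ (Submodule.mem_span_singleton_self u)
      · rw [h02 _ (by omega)]; exact Submodule.zero_mem _
    · rcases n with _ | n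
      · rw [h10]; exact Submodule.smul_mem _ _ (Submodule.mem_span_singleton_self u)
      · rw [h11 _ (by omega)]; exact Submodule.zero_mem _
    · rw [hk _ (by omega)]; exact Submodule.zero_mem _
  have hne : Δ ≠ 0 ∨ β ≠ 0 := by
    by_contra! h
    obtain ⟨rfl, rfl⟩ := h
    obtain ⟨i, n, hin⟩ := exists_mode_notMem_span hirr hu α
    apply hin
    rcases i with _ | _ | i
    · rcases n with _ | _ | n
      · rw [h00, neg_smul]
        exact Submodule.neg_mem _ (Submodule.mem_span_singleton_self _)
      · rw [hu1, mul_zero, zero_smul]; exact Submodule.zero_mem _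
      · rw [h02 _ (by omega)]; exact Submodule.zero_mem _
    · rcases n with _ | n
      · rw [h10, C_0, zero_smul]; exact Submodule.zero_mem _
      · rw [h11 _ (by omega)]; exact Submodule.zero_mem _
    · rw [hk _ (by omega)]; exact Submodule.zero_mem _
  have hiso : ρ.IsFreeOfRankOne ∧ ρ.Isomorphic (modN Δ α β) :=
    isomorphic_rankOneModule _ hu hspan (fun i l => by
      rcases i with _ | _ | i
      · rw [eval_field_of_mode h02, h00, hu1, ← C_smul, ← C_smul, smul_smul, ← add_smul]
        congr 1
        simp; ring
      · rw [eval_field_of_mode (fun n hn => h11 n (by omega)), h10, h11 1 le_rfl]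
        simp
      · rw [hzero _ (by omega)]; simp)
  exact ⟨hiso.1, Δ, α, β, hne, hiso.2⟩

end Classification

end Conformal

end

theorem theorem5p1 :
    (∀ p : ℂ, p ≠ 0 → p ≠ -1 →
      ∀ (M : Type*) [AddCommGroup M] [Module ℂ M] [Module ℂ[X] M] [IsScalarTower ℂ ℂ[X] M]
        (ρ : Conformal.ConformalModule (Conformal.block p) M),
        ρ.IsNontrivial → ρ.IsFinite → ρ.IsIrreducible →
          ρ.IsFreeOfRankOne ∧ ∃ Δ α : ℂ, Δ ≠ 0 ∧ ρ.Isomorphic (Conformal.modM p Δ α)) ∧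
    (∀ (M : Type*) [AddCommGroup M] [Module ℂ M] [Module ℂ[X] M] [IsScalarTower ℂ ℂ[X] M]
        (ρ : Conformal.ConformalModule (Conformal.block (-1)) M),
        ρ.IsNontrivial → ρ.IsFinite → ρ.IsIrreducible →
          ρ.IsFreeOfRankOne ∧
            ∃ Δ α β : ℂ, (Δ ≠ 0 ∨ β ≠ 0) ∧ ρ.Isomorphic (Conformal.modN Δ α β)) :=
  ⟨fun _ hp hp1 _ _ _ _ _ ρ => Conformal.classification_of_ne_neg_one hp hp1 ρ,
    fun _ _ _ _ _ ρ => Conformal.classification_of_eq_neg_one ρ⟩
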